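/- **Setting.** Let $G$ be a topological groupoid whose domain map $d:G\to G_0$ is a local homeomorphism (i.e. $G$ is étale) and whose object space $G_0\subset G$ is locally compact Hausdorff ($G$ itself need not be Hausdorff). A *local bisection* of $G$ is an open set $U\subset G$ on which both $d$ and the range map $r$ are injective; $\mathcal I(G)$ is the set of local bisections. The topology $\mathcal O(G)$ is an involutive quantale with $UV=\{gh : g\in U,\ h\in V,\ d(g)=r(h)\}$ and $U^*=U^{-1}$. For a C*-algebra $A$, $\mathrm{Max}\,A$ is the involutive quantale of closed linear subspaces of $A$, ordered by inclusion, with $VW=\overline{\mathrm{span}}\{ab : a\in V,\ b\in W\}$ and $V^*=\{a^*: a\in V\}$. A *map of involutive quantales* $p:Q\to X$ is a function $p^*:X\to Q$ that preserves arbitrary joins, multiplication and involution; $p$ is a *surjection* if $p^*$ is injective. A *Banach bundle* over $G$ is a continuous open surjection $\pi:E\to G$ whose fibers $E_g$ are complex Banach spaces, such that: $\pi^{-1}(U)$ is Hausdorff for every Hausdorff open $U\subset G$; addition is continuous on $E\times_G E$; multiplication by each scalar is continuous on $E$; the norm is upper semicontinuous on $E$; and for each $g\in G$ and each open $V\subset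 E$ containing $0_g$ there are $\varepsilon>0$ and an open $U\ni g$ with $\{e\in\pi^{-1}(U): \|e\|<\varepsilon\}\subset V$. A *Fell bundle* on $G$ is a Banach bundle over $G$ with a continuous associative multiplication, defined on the pairs $(e,f)$ with $d(\pi(e))=r(\pi(f))$ and restricting to bilinear maps $E_g\times E_h\to E_{gh}$, and a continuous involution restricting to conjugate-linear maps $E_g\to E_{g^{-1}}$, such that $e^{**}=e$, $(ef)^*=f^*e^*$, $\|ef\|\le\|e\|\|f\|$, $\|e^*\|=\|e\|$, $\|e^*e\|=\|e\|^2$, and $e^*e\ge 0$ in the C*-algebra $E_{d(\pi(e))}$. It is *saturated* if for all $g,h$ with $d(g)=r(h)$ the closed linear span of the products $ef$ with $e\in E_g$, $f\in E_h$ is $E_{gh}$, and *nondegenerate* if $E_g\neq\{0\}$ for all $g\in G$. For $U\in\mathcal I(G)$, $C_c(U,E)$ is the space of sections $s:G\to E$ of $\pi$ that are continuous on $U$ and vanish outside some compact subset of $U$. The *convolution algebra* $S_c(G,E)$ is the linear span of all the spaces $C_c(U,E)$ with $U\in\mathcal I(G)$, with product $(st)(g)=\sum_{g=hk}s(h)t(k)$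 and involution $s^*(g)=s(g^{-1})^*$. A *compatible C\*-completion* $A$ is the completion of $S_c(G,E)$ in a C*-norm $\|\cdot\|$ such that $\sup_{g}\|s(g)\|\le\|s\|$ for all $s\in S_c(G,E)$, with equality whenever $s\in C_c(U,E)$ for some $U\in\mathcal I(G)$. Write $A|_U$ for the closure of $C_c(U,E)$ in $A$. **Theorem.** Let $\pi:E\to G$ be a saturated Fell bundle on $G$ as above and let $A$ be a compatible C*-completion. There is a unique map of involutive quantales $p:\mathrm{Max}\,A\to\mathcal O(G)$ such that $$p^*(U)=A|_U\qquad\text{for all }U\in\mathcal I(G).$$ For every open $V\subset G$ and every family $(U_\alpha)$ of local bisections with $V=\bigcup_\alpha U_\alpha$ we have $p^*(V)=\bigvee_\alpha A|_{U_\alpha}$, the join being taken in $\mathrm{Max}\,A$. Moreover, $p$ is a surjection if and only if the bundle is nondegenerate. -/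

import Mathlib

namespace FellQuantale

noncomputable section

open TopologicalSpace Bundle

/-! ### Involutive quantales -/

/-- An involutive quantale: a complete lattice with a semigroup multiplication that preserves
arbitrary joins in each variable, and a join preserving semigroup involution. -/
class IsInvolutiveQuantale (Q : Type*) [CompleteLattice Q] [Semigroup Q] [StarMul Q] : Prop
    extends IsQuantale Q where
  star_sSup : ∀ S : Set Q, star (sSup S) = ⨆ a ∈ S, star a

/-- Homomorphisms of involutive quantales (not required to preserve any units). -/
@[ext]
structure InvolutiveQuantaleHom (X Q : Type*)
    [CompleteLattice X] [Semigroup X] [StarMul X] [IsInvolutiveQuantale X]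
    [CompleteLattice Q] [Semigroup Q] [StarMul Q] [IsInvolutiveQuantale Q] where
  toFun : X → Q
  map_sSup : ∀ S : Set X, toFun (sSup S) = ⨆ a ∈ S, toFun a
  map_mul : ∀ a b : X, toFun (a * b) = toFun a * toFun b
  map_star : ∀ a : X, toFun (star a) = star (toFun a)

/-- A (continuous) map `p : Q → X` of involutive quantales is, by definition, a homomorphism
`p^* : X → Q` in the opposite direction. -/
@[ext]
structure QuantaleMap (Q X : Type*)
    [CompleteLattice Q] [Semigroup Q] [StarMul Q] [IsInvolutiveQuantale Q]
    [CompleteLattice X] [Semigroup X] [StarMul X] [IsInvolutiveQuantale X] where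
  invImage : InvolutiveQuantaleHom X Q

/-- A map `p` of involutive quantales is a surjection if `p^*` is injective. -/
def QuantaleMap.IsSurjection {Q X : Type*}
    [CompleteLattice Q] [Semigroup Q] [StarMul Q] [IsInvolutiveQuantale Q]
    [CompleteLattice X] [Semigroup X] [StarMul X] [IsInvolutiveQuantale X]
    (p : QuantaleMap Q X) : Prop :=
  Function.Injective p.invImage.toFun

/-! ### The spectrum of a C*-algebra -/

/-- `Max A`: the closed linear subspaces of `A`, ordered by inclusion. -/
abbrev MaxSpec (A : Type*) [NonUnitalCStarAlgebra A] := ClosedSubmodule ℂ A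

section MaxSpec

variable {A : Type*} [NonUnitalCStarAlgebra A]

/-- `V W` is the closure of the linear span of the products `a b` with `a ∈ V`, `b ∈ W`. -/
instance : Mul (MaxSpec A) where
  mul V W := (Submodule.span ℂ (Set.image2 (fun a b => a * b) (V : Set A) (W : Set A))).closure

/-- `V^* = {a^* | a ∈ V}`, written as the preimage of `V` under the involution. -/
instance : Star (MaxSpec A) where
  star V :=
    { carrier := {a | star a ∈ V}
      add_mem' := fun {a b} ha hb => by
        simpa only [Set.mem_ofPred_eq, star_add] using add_mem ha hb
      zero_mem' := by simpa only [Set.mem_ofPred_eq, star_zero] using zero_mem V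
      smul_mem' := fun c a ha => by
        simpa only [Set.mem_ofPred_eq, star_smul] using SMulMemClass.smul_mem (star c) ha
      isClosed' := V.isClosed.preimage continuous_star }

theorem mem_star_iff {V : MaxSpec A} {a : A} : a ∈ star V ↔ star a ∈ V := Iff.rfl

theorem mul_mem_mul {V W : MaxSpec A} {a b : A} (ha : a ∈ V) (hb : b ∈ W) : a * b ∈ V * W :=
  subset_closure (Submodule.subset_span (Set.mem_image2_of_mem ha hb))

theorem mul_le_iff {V W T : MaxSpec A} : V * W ≤ T ↔ ∀ a ∈ V, ∀ b ∈ W, a * b ∈ T := by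
  refine ⟨fun h a ha b hb => h (mul_mem_mul ha hb), fun h => ?_⟩
  refine Submodule.closure_le.2 (Submodule.span_le.2 ?_)
  rintro _ ⟨a, ha, b, hb, rfl⟩
  exact h a ha b hb

/-- The closed subspace `{a | a b ∈ T for all b ∈ W}`. -/
def leftQuot (T W : MaxSpec A) : MaxSpec A where
  carrier := {a | ∀ b ∈ W, a * b ∈ T}
  add_mem' := fun {a a'} ha ha' b hb => by
    simpa only [add_mul] using add_mem (ha b hb) (ha' b hb)
  zero_mem' := fun b _ => by simpa only [zero_mul] using zero_mem T
  smul_mem' := fun c a ha b hb => by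
    simpa only [smul_mul_assoc] using SMulMemClass.smul_mem c (ha b hb)
  isClosed' := by
    have h : {a : A | ∀ b ∈ W, a * b ∈ T} = ⋂ b ∈ W, (fun a => a * b) ⁻¹' (T : Set A) := by
      ext a; simp
    change IsClosed {a : A | ∀ b ∈ W, a * b ∈ T}
    rw [h]
    exact isClosed_biInter fun b _ => T.isClosed.preimage (continuous_mul_const b)

/-- The closed subspace `{b | a b ∈ T for all a ∈ V}`. -/
def rightQuot (V T : MaxSpec A) : MaxSpec A where
  carrier := {b | ∀ a ∈ V, a * b ∈ T}
  add_mem' := fun {b b'} hb hb' a ha => by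
    simpa only [mul_add] using add_mem (hb a ha) (hb' a ha)
  zero_mem' := fun a _ => by simpa only [mul_zero] using zero_mem T
  smul_mem' := fun c b hb a ha => by
    simpa only [mul_smul_comm] using SMulMemClass.smul_mem c (hb a ha)
  isClosed' := by
    have h : {b : A | ∀ a ∈ V, a * b ∈ T} = ⋂ a ∈ V, (fun b => a * b) ⁻¹' (T : Set A) := by
      ext a; simp
    change IsClosed {b : A | ∀ a ∈ V, a * b ∈ T}
    rw [h]
    exact isClosed_biInter fun a _ => T.isClosed.preimage (continuous_const_mul a)

theorem mul_le_iff_left {V W T : MaxSpec A} : V * W ≤ T ↔ V ≤ leftQuot T W := mul_le_iff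

theorem mul_le_iff_right {V W T : MaxSpec A} : V * W ≤ T ↔ W ≤ rightQuot V T :=
  mul_le_iff.trans ⟨fun h b hb a ha => h a ha b hb, fun h a ha _ hb => h hb a ha⟩

theorem star_le_iff {V W : MaxSpec A} : star V ≤ W ↔ V ≤ star W :=
  ⟨fun h a ha => h (show star (star a) ∈ V by rwa [star_star]),
    fun h a ha => by have := h ha; rwa [mem_star_iff, star_star] at this⟩

instance : Semigroup (MaxSpec A) where
  mul_assoc V W T := by
    apply le_antisymm
    · rw [mul_le_iff_left, mul_le_iff]
      intro a ha b hb c hc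
      rw [mul_assoc]
      exact mul_mem_mul ha (mul_mem_mul hb hc)
    · rw [mul_le_iff_right, mul_le_iff]
      intro b hb c hc a ha
      rw [← mul_assoc]
      exact mul_mem_mul (mul_mem_mul ha hb) hc

theorem star_star_max (V : MaxSpec A) : star (star V) = V := by
  ext a
  change star (star a) ∈ V ↔ a ∈ V
  rw [star_star]

instance : StarMul (MaxSpec A) where
  star_involutive := star_star_max
  star_mul V W := by
    have key : ∀ V W : MaxSpec A, star (V * W) ≤ star W * star V := by
      intro V W
      rw [star_le_iff, mul_le_iff]
      intro a ha b hb
      rw [mem_star_iff, star_mul]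
      exact mul_mem_mul (by rwa [mem_star_iff, star_star]) (by rwa [mem_star_iff, star_star])
    apply le_antisymm (key V W)
    rw [← star_le_iff]
    simpa only [star_star_max] using key (star W) (star V)

instance : IsInvolutiveQuantale (MaxSpec A) where
  mul_sSup_distrib V S := by
    refine eq_of_forall_ge_iff fun T => ?_
    simp only [mul_le_iff_right, sSup_le_iff, iSup_le_iff]
  sSup_mul_distrib S V := by
    refine eq_of_forall_ge_iff fun T => ?_
    simp only [mul_le_iff_left, sSup_le_iff, iSup_le_iff]
  star_sSup S := by
    refine eq_of_forall_ge_iff fun T => ?_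
    simp only [star_le_iff, sSup_le_iff, iSup_le_iff]

end MaxSpec

/-! ### Étale groupoids -/

/-- A topological groupoid, given by its space of arrows `G`; the objects are identified with the
unit arrows. The product `g h` is defined when `dom g = ran h`. -/
class TopologicalGroupoid (G : Type*) [TopologicalSpace G] where
  dom : G → G
  ran : G → G
  inv : G → G
  mul : (g h : G) → dom g = ran h → G
  dom_dom : ∀ g, dom (dom g) = dom g
  ran_dom : ∀ g, ran (dom g) = dom g
  dom_ran : ∀ g, dom (ran g) = ran g
  ran_ran : ∀ g, ran (ran g) = ran g
  dom_mul : ∀ g h c, dom (mul g h c) = dom h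
  ran_mul : ∀ g h c, ran (mul g h c) = ran g
  dom_inv : ∀ g, dom (inv g) = ran g
  ran_inv : ∀ g, ran (inv g) = dom g
  mul_assoc : ∀ (g h k : G) (c : dom g = ran h) (c' : dom h = ran k),
    mul (mul g h c) k ((dom_mul g h c).trans c') = mul g (mul h k c') (c.trans (ran_mul h k c').symm)
  mul_dom : ∀ g, mul g (dom g) (ran_dom g).symm = g
  ran_mul_self : ∀ g, mul (ran g) g (dom_ran g) = g
  inv_mul : ∀ g, mul (inv g) g (dom_inv g) = dom g
  mul_inv : ∀ g, mul g (inv g) (ran_inv g).symm = ran g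
  continuous_dom : Continuous dom
  continuous_ran : Continuous ran
  continuous_inv : Continuous inv
  continuous_mul : Continuous fun p : {p : G × G // dom p.1 = ran p.2} => mul p.1.1 p.1.2 p.2

namespace TopologicalGroupoid

section Basic

variable {G : Type*} [TopologicalSpace G] [TopologicalGroupoid G]

/-- The space of objects `G₀`, as the subspace of unit arrows of `G`. -/
abbrev Obj (G : Type*) [TopologicalSpace G] [TopologicalGroupoid G] := {x : G // dom x = x}

/-- The domain map as a map `G → G₀`. -/
def domMap (g : G) : Obj G := ⟨dom g, dom_dom g⟩

/-- The range map as a map `G → G₀`. -/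
def ranMap (g : G) : Obj G := ⟨ran g, dom_ran g⟩

/-- `Comp g h k` means that `g h` is defined and equal to `k`. -/
def Comp (g h k : G) : Prop := ∃ c : dom g = ran h, mul g h c = k

theorem Comp.dom_eq {g h k : G} (c : Comp g h k) : dom k = dom h := by
  obtain ⟨c, rfl⟩ := c; exact dom_mul g h c

theorem Comp.ran_eq {g h k : G} (c : Comp g h k) : ran k = ran g := by
  obtain ⟨c, rfl⟩ := c; exact ran_mul g h c

theorem Comp.mid {g h k : G} (c : Comp g h k) : dom g = ran h := c.1

theorem comp_mul (g h : G) (c : dom g = ran h) : Comp g h (mul g h c) := ⟨c, rfl⟩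

theorem comp_inv_self (g : G) : Comp (inv g) g (dom g) := ⟨dom_inv g, inv_mul g⟩

theorem comp_self_inv (g : G) : Comp g (inv g) (ran g) := ⟨(ran_inv g).symm, mul_inv g⟩

theorem comp_dom_self (g : G) : Comp g (dom g) g := ⟨_, mul_dom g⟩

theorem comp_ran_self (g : G) : Comp (ran g) g g := ⟨_, ran_mul_self g⟩

theorem comp_dom_dom (g : G) : Comp (dom g) (dom g) (dom g) := by
  simpa only [dom_dom] using comp_dom_self (dom g)

theorem Comp.unique {g h k k' : G} (c : Comp g h k) (c' : Comp g h k') : k = k' := by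
  obtain ⟨c, rfl⟩ := c; obtain ⟨c', rfl⟩ := c'; rfl

theorem Comp.assoc {g h k a b l : G} (c₁ : Comp g h a) (c₂ : Comp h k b) :
    Comp a k l ↔ Comp g b l := by
  obtain ⟨c₁, rfl⟩ := c₁
  obtain ⟨c₂, rfl⟩ := c₂
  constructor
  · rintro ⟨c, rfl⟩
    exact ⟨_, (mul_assoc g h k c₁ c₂).symm⟩
  · rintro ⟨c, rfl⟩
    exact ⟨_, mul_assoc g h k c₁ c₂⟩

theorem Comp.inv_left {g h k : G} (c : Comp g h k) : Comp (inv g) k h := by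
  have h1 : Comp (dom g) h h := by rw [c.mid]; exact comp_ran_self h
  exact (Comp.assoc (comp_inv_self g) c).1 h1

theorem Comp.inv_right {g h k : G} (c : Comp g h k) : Comp k (inv h) g := by
  have h1 : Comp g (ran h) g := by rw [← c.mid]; exact comp_dom_self g
  exact (Comp.assoc c (comp_self_inv h)).2 h1

theorem Comp.right_cancel {g h h' k : G} (c : Comp g h k) (c' : Comp g h' k) : h = h' :=
  c.inv_left.unique c'.inv_left

theorem inv_dom (g : G) : inv (dom g) = dom g := by
  have h1 : Comp (inv (dom g)) (dom g) (dom g) := by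
    simpa only [dom_dom] using comp_inv_self (dom g)
  have h2 : Comp (inv (dom g)) (dom g) (inv (dom g)) := by
    have := comp_dom_self (inv (dom g))
    rwa [dom_inv, ran_dom] at this
  exact h2.unique h1

theorem inv_inv (g : G) : inv (inv g) = g := by
  have h1 : Comp (inv (inv g)) (dom g) g := (comp_inv_self g).inv_left
  have h2 : Comp (inv (inv g)) (dom g) (inv (inv g)) := by
    have := comp_dom_self (inv (inv g))
    rwa [dom_inv, ran_inv] at this
  exact h2.unique h1

theorem Comp.inv {g h k : G} (c : Comp g h k) :
    Comp (inv h) (TopologicalGroupoid.inv g) (TopologicalGroupoid.inv k) :=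
  c.inv_left.inv_right.inv_left

theorem continuous_domMap : Continuous (domMap : G → Obj G) :=
  continuous_dom.subtype_mk _

theorem continuous_ranMap : Continuous (ranMap : G → Obj G) :=
  continuous_ran.subtype_mk _

/-- Inversion as a homeomorphism. -/
def invHomeo (G : Type*) [TopologicalSpace G] [TopologicalGroupoid G] : G ≃ₜ G where
  toFun := inv
  invFun := inv
  left_inv := inv_inv
  right_inv := inv_inv
  continuous_toFun := continuous_inv
  continuous_invFun := continuous_inv

end Basic

/-- A topological groupoid is étale if its domain map `G → G₀` is a local homeomorphism. -/
class IsEtale (G : Type*) [TopologicalSpace G] [TopologicalGroupoid G] : Prop where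
  isLocalHomeomorph_domMap : IsLocalHomeomorph (domMap : G → Obj G)

section Etale

variable {G : Type*} [TopologicalSpace G] [TopologicalGroupoid G]

/-- A local bisection: an open set on which the domain and range maps are injective. -/
def IsLocalBisection (U : Opens G) : Prop :=
  Set.InjOn (dom : G → G) (U : Set G) ∧ Set.InjOn (ran : G → G) (U : Set G)

/-- The involution of the quantale `𝒪(G)`: `U⁻¹ = {g⁻¹ | g ∈ U}`, written as the preimage of `U`
under inversion. -/
instance : Star (Opens G) where
  star U := ⟨{g : G | inv g ∈ U}, U.isOpen.preimage continuous_inv⟩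

theorem mem_star_iff {U : Opens G} {g : G} : g ∈ star U ↔ inv g ∈ U := Iff.rfl

theorem IsLocalBisection.star {U : Opens G} (hU : IsLocalBisection U) :
    IsLocalBisection (star U) := by
  constructor
  · intro g hg g' hg' e
    have : inv g = inv g' := hU.2 hg hg' (by rw [ran_inv, ran_inv, e])
    rw [← inv_inv g, this, inv_inv]
  · intro g hg g' hg' e
    have : inv g = inv g' := hU.1 hg hg' (by rw [dom_inv, dom_inv, e])
    rw [← inv_inv g, this, inv_inv]

variable [IsEtale G]

theorem isLocalHomeomorph_domMap : IsLocalHomeomorph (domMap : G → Obj G) :=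
  IsEtale.isLocalHomeomorph_domMap

theorem isLocalHomeomorph_ranMap : IsLocalHomeomorph (ranMap : G → Obj G) := by
  have h : (ranMap : G → Obj G) = domMap ∘ invHomeo G := by
    funext g
    exact Subtype.ext (dom_inv g).symm
  rw [h]
  exact isLocalHomeomorph_domMap.comp (invHomeo G).isLocalHomeomorph

/-- The pointwise product of two open sets of an étale groupoid is open. -/
theorem isOpen_mul (U V : Opens G) : IsOpen {g : G | ∃ h ∈ U, ∃ k ∈ V, Comp h k g} := by
  rw [isOpen_iff_mem_nhds]
  rintro g₀ ⟨h₀, hU, k₀, hV, c₀⟩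
  obtain ⟨e, he, hr⟩ := isLocalHomeomorph_ranMap h₀
  have hr' : ∀ g : G, e g = ranMap g := fun g => (congrFun hr g).symm
  let W : Set G := ranMap ⁻¹' e.target
  have hW : IsOpen W := e.open_target.preimage continuous_ranMap
  have hσ : Continuous fun w : W => e.symm (ranMap w.1) :=
    e.continuousOn_symm.comp_continuous (continuous_ranMap.comp continuous_subtype_val)
      fun w => w.2
  have hrσ : ∀ w : W, ran (e.symm (ranMap w.1)) = ran w.1 := fun w => by
    have := e.right_inv w.2
    rw [hr'] at this
    exact congrArg Subtype.val this
  have hp : Continuous fun w : W => (⟨(inv (e.symm (ranMap w.1)), w.1),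
      (dom_inv _).trans (hrσ w)⟩ : {p : G × G // dom p.1 = ran p.2}) :=
    Continuous.subtype_mk ((continuous_inv.comp hσ).prodMk continuous_subtype_val) _
  have hk : Continuous fun w : W =>
      mul (inv (e.symm (ranMap w.1))) w.1 ((dom_inv _).trans (hrσ w)) :=
    continuous_mul.comp hp
  have hO := (U.isOpen.preimage hσ).inter (V.isOpen.preimage hk)
  have hO' := hW.isOpenMap_subtype_val _ hO
  have hrg : ranMap g₀ = e h₀ := by rw [hr']; exact Subtype.ext c₀.ran_eq
  have hgW : g₀ ∈ W := by
    change ranMap g₀ ∈ e.target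
    rw [hrg]; exact e.map_source he
  have hσ0 : e.symm (ranMap g₀) = h₀ := by rw [hrg]; exact e.left_inv he
  refine Filter.mem_of_superset (hO'.mem_nhds ⟨⟨g₀, hgW⟩, ⟨?_, ?_⟩, rfl⟩) ?_
  · change e.symm (ranMap g₀) ∈ U
    rwa [hσ0]
  · change mul (inv (e.symm (ranMap g₀))) g₀ _ ∈ V
    have h1 : Comp (inv (e.symm (ranMap g₀))) g₀ k₀ := by rw [hσ0]; exact c₀.inv_left
    obtain ⟨_, h2⟩ := h1
    rwa [h2]
  · rintro _ ⟨w, ⟨h1, h2⟩, rfl⟩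
    refine ⟨_, h1, _, h2, ?_⟩
    have := (comp_mul _ _ ((dom_inv _).trans (hrσ w))).inv_left
    rwa [inv_inv] at this

/-- The multiplication of the quantale `𝒪(G)`: the pointwise product of open sets. -/
instance : Mul (Opens G) where
  mul U V := ⟨{g : G | ∃ h ∈ U, ∃ k ∈ V, Comp h k g}, isOpen_mul U V⟩

theorem mem_mul_iff {U V : Opens G} {g : G} :
    g ∈ U * V ↔ ∃ h ∈ U, ∃ k ∈ V, Comp h k g := Iff.rfl

instance : Semigroup (Opens G) where
  mul_assoc U V W := by
    ext g
    constructor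
    · rintro ⟨a, ⟨u, hu, v, hv, c₁⟩, w, hw, c₂⟩
      have c₃ := comp_mul v w (c₁.dom_eq.symm.trans c₂.mid)
      exact ⟨u, hu, _, ⟨v, hv, w, hw, c₃⟩, (Comp.assoc c₁ c₃).1 c₂⟩
    · rintro ⟨u, hu, b, ⟨v, hv, w, hw, c₁⟩, c₂⟩
      have c₃ := comp_mul u v (c₂.mid.trans c₁.ran_eq)
      exact ⟨_, ⟨u, hu, v, hv, c₃⟩, w, hw, (Comp.assoc c₃ c₁).2 c₂⟩

instance : StarMul (Opens G) where
  star_involutive U := by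
    ext g
    change inv (inv g) ∈ U ↔ g ∈ U
    rw [inv_inv]
  star_mul U V := by
    ext g
    constructor
    · rintro ⟨u, hu, v, hv, c⟩
      refine ⟨inv v, ?_, inv u, ?_, ?_⟩
      · change inv (inv v) ∈ V
        rwa [inv_inv]
      · change inv (inv u) ∈ U
        rwa [inv_inv]
      · simpa only [inv_inv] using c.inv
    · rintro ⟨v, hv, u, hu, c⟩
      exact ⟨inv u, hu, inv v, hv, c.inv⟩

instance : IsInvolutiveQuantale (Opens G) where
  mul_sSup_distrib U S := by
    ext g
    simp only [SetLike.mem_coe, mem_mul_iff, Opens.mem_sSup, Opens.mem_iSup]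
    constructor
    · rintro ⟨h, hU, k, ⟨V, hV, hk⟩, c⟩
      exact ⟨V, hV, h, hU, k, hk, c⟩
    · rintro ⟨V, hV, h, hU, k, hk, c⟩
      exact ⟨h, hU, k, ⟨V, hV, hk⟩, c⟩
  sSup_mul_distrib S V := by
    ext g
    simp only [SetLike.mem_coe, mem_mul_iff, Opens.mem_sSup, Opens.mem_iSup]
    constructor
    · rintro ⟨h, ⟨U, hU, hh⟩, k, hk, c⟩
      exact ⟨U, hU, h, hh, k, hk, c⟩
    · rintro ⟨U, hU, h, hh, k, hk, c⟩
      exact ⟨h, ⟨U, hU, hh⟩, k, hk, c⟩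
  star_sSup S := by
    ext g
    simp only [SetLike.mem_coe, mem_star_iff, Opens.mem_sSup, Opens.mem_iSup, exists_prop]

theorem IsLocalBisection.isOpenEmbedding_dom {U : Opens G} (hU : IsLocalBisection U) :
    Topology.IsOpenEmbedding fun u : U => domMap u.1 :=
  .of_continuous_injective_isOpenMap (continuous_domMap.comp continuous_subtype_val)
    (fun u v h => Subtype.ext (hU.1 u.2 v.2 (congrArg Subtype.val h)))
    (isLocalHomeomorph_domMap.isOpenMap.comp U.isOpen.isOpenMap_subtype_val)

theorem IsLocalBisection.isOpenEmbedding_ran {U : Opens G} (hU : IsLocalBisection U) :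
    Topology.IsOpenEmbedding fun u : U => ranMap u.1 :=
  .of_continuous_injective_isOpenMap (continuous_ranMap.comp continuous_subtype_val)
    (fun u v h => Subtype.ext (hU.2 u.2 v.2 (congrArg Subtype.val h)))
    (isLocalHomeomorph_ranMap.isOpenMap.comp U.isOpen.isOpenMap_subtype_val)

theorem IsLocalBisection.mul {U V : Opens G} (hU : IsLocalBisection U) (hV : IsLocalBisection V) :
    IsLocalBisection (U * V) := by
  constructor
  · rintro g ⟨h, hh, k, hk, c⟩ g' ⟨h', hh', k', hk', c'⟩ e
    have e1 : k = k' := hV.1 hk hk' (by rw [← c.dom_eq, ← c'.dom_eq, e])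
    subst e1
    have e2 : h = h' := hU.1 hh hh' (by rw [c.mid, c'.mid])
    subst e2
    exact c.unique c'
  · rintro g ⟨h, hh, k, hk, c⟩ g' ⟨h', hh', k', hk', c'⟩ e
    have e1 : h = h' := hU.2 hh hh' (by rw [← c.ran_eq, ← c'.ran_eq, e])
    subst e1
    have e2 : k = k' := hV.2 hk hk' (by rw [← c.mid, ← c'.mid])
    subst e2
    exact c.unique c'

end Etale

/-- Pointwise products of compact sets are compact when the object space is Hausdorff. -/
theorem isCompact_mul {G : Type*} [TopologicalSpace G] [TopologicalGroupoid G] [T2Space (Obj G)]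
    {K L : Set G} (hK : IsCompact K) (hL : IsCompact L) :
    IsCompact {g : G | ∃ h ∈ K, ∃ k ∈ L, Comp h k g} := by
  have hcl : IsClosed {p : G × G | dom p.1 = ran p.2} := by
    have h : {p : G × G | dom p.1 = ran p.2} =
        {p : G × G | domMap p.1 = ranMap p.2} := by
      ext p
      exact ⟨fun h => Subtype.ext h, fun h => congrArg Subtype.val h⟩
    rw [h]
    exact isClosed_eq (continuous_domMap.comp continuous_fst)
      (continuous_ranMap.comp continuous_snd)
  have h1 : IsCompact (Subtype.val ⁻¹' (K ×ˢ L) : Set {p : G × G // dom p.1 = ran p.2}) :=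
    hcl.isClosedEmbedding_subtypeVal.isCompact_preimage (hK.prod hL)
  convert h1.image continuous_mul using 1
  ext g
  constructor
  · rintro ⟨h, hh, k, hk, c, rfl⟩
    exact ⟨⟨(h, k), c⟩, ⟨hh, hk⟩, rfl⟩
  · rintro ⟨⟨⟨h, k⟩, c⟩, ⟨hh, hk⟩, rfl⟩
    exact ⟨h, hh, k, hk, c, rfl⟩

end TopologicalGroupoid

open TopologicalGroupoid

/-! ### Banach bundles and Fell bundles -/

/-- The total space of a family of fibers. (The first argument of `Bundle.TotalSpace` is a
placeholder for a model fiber, which plays no role here.) -/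
abbrev Tot {X : Type*} (E : X → Type*) := TotalSpace PUnit.{1} E

/-- An upper semicontinuous Banach bundle over `X` with fibers the Banach spaces `E x`. -/
class BanachBundle {X : Type*} [TopologicalSpace X] (E : X → Type*)
    [∀ x, NormedAddCommGroup (E x)] [∀ x, NormedSpace ℂ (E x)] [∀ x, CompleteSpace (E x)]
    [TopologicalSpace (Tot E)] : Prop where
  continuous_proj : Continuous fun e : Tot E => e.proj
  isOpenMap_proj : IsOpenMap fun e : Tot E => e.proj
  t2_restrict : ∀ U : Set X, IsOpen U → T2Space U → T2Space {e : Tot E // e.proj ∈ U}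
  continuous_add : Continuous fun p : TotalSpace (PUnit.{1} × PUnit.{1}) (E ×ᵇ E) =>
    (⟨p.proj, p.snd.1 + p.snd.2⟩ : Tot E)
  continuous_smul : ∀ c : ℂ, Continuous fun e : Tot E => (⟨e.proj, c • e.snd⟩ : Tot E)
  upperSemicontinuous_norm : UpperSemicontinuous fun e : Tot E => ‖e.snd‖
  tube_basis : ∀ (x : X) (V : Set (Tot E)), IsOpen V → (⟨x, 0⟩ : Tot E) ∈ V →
    ∃ ε : ℝ, 0 < ε ∧ ∃ U : Set X, IsOpen U ∧ x ∈ U ∧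
      ∀ e : Tot E, e.proj ∈ U → ‖e.snd‖ < ε → e ∈ V

/-- A Fell bundle on the groupoid `G` with fibers `E g`. The multiplication and the involution are
given on fibers, `bmul c : E g × E h → E k` where `c` says that `g h = k`, and
`bstar c : E g → E k` where `c` says that `g⁻¹ = k`; so they are automatically compatible with the
bundle projection. -/
class FellBundle {G : Type*} [TopologicalSpace G] [TopologicalGroupoid G] (E : G → Type*)
    [∀ g, NormedAddCommGroup (E g)] [∀ g, NormedSpace ℂ (E g)] [∀ g, CompleteSpace (E g)]
    [TopologicalSpace (Tot E)] extends BanachBundle E where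
  bmul : ∀ {g h k : G}, Comp g h k → E g →ₗ[ℂ] E h →ₗ[ℂ] E k
  bstar : ∀ {g k : G}, inv g = k → E g →ₗ⋆[ℂ] E k
  continuous_bmul : Continuous fun p : {p : Tot E × Tot E // dom p.1.proj = ran p.2.proj} =>
    (⟨mul p.1.1.proj p.1.2.proj p.2, bmul (comp_mul _ _ p.2) p.1.1.snd p.1.2.snd⟩ : Tot E)
  continuous_bstar : Continuous fun e : Tot E => (⟨inv e.proj, bstar rfl e.snd⟩ : Tot E)
  bmul_assoc : ∀ {g h k gh hk l : G} (c₁ : Comp g h gh) (c₂ : Comp gh k l) (c₃ : Comp h k hk)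
    (c₄ : Comp g hk l) (a : E g) (b : E h) (c : E k),
    bmul c₂ (bmul c₁ a b) c = bmul c₄ a (bmul c₃ b c)
  bstar_bstar : ∀ {g k : G} (c : inv g = k) (c' : inv k = g) (a : E g),
    bstar c' (bstar c a) = a
  bstar_bmul : ∀ {g h k g' h' k' : G} (c : Comp g h k) (hg : inv g = g') (hh : inv h = h')
    (hk : inv k = k') (c' : Comp h' g' k') (a : E g) (b : E h),
    bstar hk (bmul c a b) = bmul c' (bstar hh b) (bstar hg a)
  norm_bmul_le : ∀ {g h k : G} (c : Comp g h k) (a : E g) (b : E h), ‖bmul c a b‖ ≤ ‖a‖ * ‖b‖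
  norm_bstar : ∀ {g k : G} (c : inv g = k) (a : E g), ‖bstar c a‖ = ‖a‖
  norm_bstar_bmul_self : ∀ {g : G} (a : E g),
    ‖bmul (comp_inv_self g) (bstar rfl a) a‖ = ‖a‖ ^ 2
  /-- `a^* a ≥ 0` in the C*-algebra `E (dom g)`, i.e. it is of the form `b^* b`
  with `b ∈ E (dom g)`. -/
  bstar_bmul_self_nonneg : ∀ {g : G} (a : E g), ∃ b : E (dom g),
    bmul (comp_inv_self g) (bstar rfl a) a =
      bmul (comp_dom_dom g) (bstar (inv_dom g) b) b

open FellBundle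

section Fell

variable {G : Type*} [TopologicalSpace G] [TopologicalGroupoid G] (E : G → Type*)
  [∀ g, NormedAddCommGroup (E g)] [∀ g, NormedSpace ℂ (E g)] [∀ g, CompleteSpace (E g)]
  [TopologicalSpace (Tot E)] [FellBundle E]

/-- The bundle is saturated: for all composable `g, h` the closed linear span of the products
of elements of `E g` and `E h` is the whole fiber over `g h`. -/
def IsSaturated : Prop :=
  ∀ (g h k : G) (c : Comp g h k),
    closure (Submodule.span ℂ (Set.range fun p : E g × E h => bmul c p.1 p.2) : Set (E k)) =
      Set.univ

end Fell

/-- The bundle is nondegenerate: no fiber is zero. -/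
def IsNondegenerate {G : Type*} (E : G → Type*) : Prop := ∀ g, Nontrivial (E g)

/-! ### The convolution algebra -/

section Convolution

variable {G : Type*} [TopologicalSpace G] [TopologicalGroupoid G] (E : G → Type*)
  [∀ g, NormedAddCommGroup (E g)] [∀ g, NormedSpace ℂ (E g)] [∀ g, CompleteSpace (E g)]
  [TopologicalSpace (Tot E)] [FellBundle E]

/-- `C_c(U, E)`: the sections of the bundle that are continuous on `U` and vanish outside some
compact subset of `U`. -/
def Cc (U : Opens G) : Submodule ℂ (∀ g, E g) where
  carrier := {s | ContinuousOn (fun g => (⟨g, s g⟩ : Tot E)) U ∧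
    ∃ K : Set G, IsCompact K ∧ K ⊆ U ∧ ∀ g, g ∉ K → s g = 0}
  zero_mem' := by
    refine ⟨?_, ∅, isCompact_empty, Set.empty_subset _, fun _ _ => rfl⟩
    apply Continuous.continuousOn
    rw [continuous_def]
    intro V hV
    rw [isOpen_iff_mem_nhds]
    intro g hg
    obtain ⟨ε, hε, W, hW, hgW, h⟩ := BanachBundle.tube_basis g V hV hg
    refine Filter.mem_of_superset (hW.mem_nhds hgW) fun g' hg' => h _ hg' ?_
    simpa using hε
  add_mem' := by
    rintro s t ⟨hs, K, hK, hKU, hsK⟩ ⟨ht, L, hL, hLU, htL⟩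
    refine ⟨?_, K ∪ L, hK.union hL, Set.union_subset hKU hLU, fun g hg => ?_⟩
    · rw [continuousOn_iff_continuous_domRestrict] at hs ht ⊢
      have h : Continuous fun g : (U : Set G) =>
          (⟨g.1, (s g.1, t g.1)⟩ : TotalSpace (PUnit.{1} × PUnit.{1}) (E ×ᵇ E)) :=
        continuous_induced_rng.2 (hs.prodMk ht)
      exact BanachBundle.continuous_add.comp h
    · rw [Pi.add_apply, hsK g fun h => hg (Or.inl h), htL g fun h => hg (Or.inr h), add_zero]
  smul_mem' := by
    rintro c s ⟨hs, K, hK, hKU, hsK⟩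
    refine ⟨?_, K, hK, hKU, fun g hg => ?_⟩
    · exact (BanachBundle.continuous_smul c).comp_continuousOn hs
    · rw [Pi.smul_apply, hsK g hg, smul_zero]

/-- The space of compactly supported sections: the linear span of the spaces `C_c(U, E)`, with `U`
ranging over all the local bisections. -/
def SectC : Submodule ℂ (∀ g, E g) := ⨆ U : {U : Opens G // IsLocalBisection U}, Cc E U.1

variable {E}

/-- The convolution product `(s t)(g) = ∑_{g = h k} s(h) t(k)`. -/
def conv (s t : ∀ g, E g) : ∀ g, E g := fun g =>
  ∑ᶠ p : {p : G × G // Comp p.1 p.2 g}, bmul p.2 (s p.1.1) (t p.1.2)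

/-- The involution `s^*(g) = s(g⁻¹)^*`. -/
def invol (s : ∀ g, E g) : ∀ g, E g := fun g => bstar (inv_inv g) (s (inv g))

theorem Cc_eq_zero {U : Opens G} {s : ∀ g, E g} (hs : s ∈ Cc E U) {g : G} (hg : g ∉ U) :
    s g = 0 := by
  obtain ⟨_, K, _, hKU, h⟩ := hs
  exact h g fun hK => hg (hKU hK)

theorem SectC_induction {P : (∀ g, E g) → Prop}
    (mem : ∀ U : Opens G, IsLocalBisection U → ∀ s ∈ Cc E U, P s) (zero : P 0)
    (add : ∀ s t, s ∈ SectC E → t ∈ SectC E → P s → P t → P (s + t))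
    {s : ∀ g, E g} (hs : s ∈ SectC E) : P s := by
  have h : s ∈ SectC E ∧ P s := by
    unfold SectC at hs
    induction hs using Submodule.iSup_induction' with
    | mem U s hs => exact ⟨Submodule.mem_iSup_of_mem U hs, mem U.1 U.2 s hs⟩
    | zero => exact ⟨zero_mem _, zero⟩
    | add s t _ _ h1 h2 => exact ⟨add_mem h1.1 h2.1, add s t h1.1 h2.1 h1.2 h2.2⟩
  exact h.2

theorem Cc_le_SectC {U : Opens G} (hU : IsLocalBisection U) : Cc E U ≤ SectC E :=
  le_iSup (fun U : {U : Opens G // IsLocalBisection U} => Cc E U.1) ⟨U, hU⟩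

theorem SectC_finite {s : ∀ g, E g} (hs : s ∈ SectC E) :
    ∀ x : G, {h : G | ran h = x ∧ s h ≠ 0}.Finite := by
  refine SectC_induction (P := fun s => ∀ x : G, {h : G | ran h = x ∧ s h ≠ 0}.Finite)
    ?_ ?_ ?_ hs
  · intro U hU s hs x
    apply Set.Subsingleton.finite
    rintro h ⟨hx, h0⟩ h' ⟨hx', h0'⟩
    refine hU.2 ?_ ?_ (hx.trans hx'.symm)
    · by_contra hn
      exact h0 (Cc_eq_zero hs hn)
    · by_contra hn
      exact h0' (Cc_eq_zero hs hn)
  · intro x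
    simp
  · intro s t _ _ h1 h2 x
    refine ((h1 x).union (h2 x)).subset ?_
    rintro h ⟨hx, h0⟩
    by_cases hs0 : s h = 0
    · exact Or.inr ⟨hx, fun ht0 => h0 (by rw [Pi.add_apply, hs0, ht0, add_zero])⟩
    · exact Or.inl ⟨hx, hs0⟩

/-- The sums that define convolution products of compactly supported sections are finite. -/
theorem conv_finite {s : ∀ g, E g} (hs : s ∈ SectC E) (t : ∀ g, E g) (g : G) :
    (Function.support fun p : {p : G × G // Comp p.1 p.2 g} =>
      bmul p.2 (s p.1.1) (t p.1.2)).Finite := by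
  refine Set.Finite.of_finite_image (f := fun p => p.1.1)
    ((SectC_finite hs (ran g)).subset ?_) ?_
  · rintro _ ⟨p, hp, rfl⟩
    refine ⟨p.2.ran_eq.symm, fun h0 => hp ?_⟩
    simp [h0]
  · rintro ⟨⟨h, k⟩, c⟩ _ ⟨⟨h', k'⟩, c'⟩ _ e
    dsimp only at e c c'
    subst e
    have := c.right_cancel c'
    subst this
    rfl

theorem conv_add_left {s s' : ∀ g, E g} (hs : s ∈ SectC E) (hs' : s' ∈ SectC E)
    (t : ∀ g, E g) : conv (s + s') t = conv s t + conv s' t := by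
  funext g
  simp only [conv, Pi.add_apply, map_add, LinearMap.add_apply]
  exact finsum_add_distrib (conv_finite hs t g) (conv_finite hs' t g)

theorem conv_add_right {s : ∀ g, E g} (hs : s ∈ SectC E) (t t' : ∀ g, E g) :
    conv s (t + t') = conv s t + conv s t' := by
  funext g
  simp only [conv, Pi.add_apply, map_add]
  exact finsum_add_distrib (conv_finite hs t g) (conv_finite hs t' g)

theorem conv_apply_of_comp {U : Opens G} (hU : IsLocalBisection U) {s t : ∀ g, E g}
    (hs : ∀ g, g ∉ U → s g = 0) {h k g : G} (hh : h ∈ U) (c : Comp h k g) :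
    conv s t g = bmul c (s h) (t k) := by
  refine (finsum_eq_single _ (⟨(h, k), c⟩ : {p : G × G // Comp p.1 p.2 g}) ?_)
  rintro ⟨⟨h', k'⟩, c'⟩ hne
  dsimp only at c' ⊢
  by_cases hh' : h' ∈ U
  · exfalso
    apply hne
    have e : h' = h := hU.2 hh' hh (c'.ran_eq.symm.trans c.ran_eq)
    subst e
    have := c.right_cancel c'
    subst this
    rfl
  · rw [hs h' hh', map_zero, LinearMap.zero_apply]

theorem conv_apply_eq_zero {K L : Set G} {s t : ∀ g, E g}
    (hs : ∀ g, g ∉ K → s g = 0) (ht : ∀ g, g ∉ L → t g = 0) {g : G}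
    (hg : ¬ ∃ h ∈ K, ∃ k ∈ L, Comp h k g) : conv s t g = 0 := by
  refine finsum_eq_zero_of_forall_eq_zero fun p => ?_
  by_cases hK : p.1.1 ∈ K
  · by_cases hL : p.1.2 ∈ L
    · exact absurd ⟨_, hK, _, hL, p.2⟩ hg
    · rw [ht _ hL, map_zero]
  · rw [hs _ hK, map_zero, LinearMap.zero_apply]

theorem invol_mem_Cc {U : Opens G} {s : ∀ g, E g} (hs : s ∈ Cc E U) :
    invol s ∈ Cc E (star U) := by
  obtain ⟨hsc, K, hK, hKU, hsK⟩ := hs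
  refine ⟨?_, inv ⁻¹' K, (invHomeo G).isClosedEmbedding.isCompact_preimage hK,
    fun g hg => hKU hg, fun g hg => ?_⟩
  · have h1 : ContinuousOn (fun g : G => (⟨inv g, s (inv g)⟩ : Tot E)) (star U : Opens G) :=
      hsc.comp (g := fun g => (⟨g, s g⟩ : Tot E)) continuous_inv.continuousOn fun g hg => hg
    convert continuous_bstar.comp_continuousOn h1 using 1
    funext g
    have key : ∀ (g' : G) (c : inv (inv g) = g'),
        (⟨g', bstar c (s (inv g))⟩ : Tot E) = ⟨inv (inv g), bstar rfl (s (inv g))⟩ := by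
      rintro _ rfl
      rfl
    exact key g (inv_inv g)
  · change bstar _ (s (inv g)) = 0
    rw [hsK (inv g) hg, map_zero]

theorem invol_mem {s : ∀ g, E g} (hs : s ∈ SectC E) : invol s ∈ SectC E := by
  refine SectC_induction (P := fun s => invol s ∈ SectC E) ?_ ?_ ?_ hs
  · intro U hU s hs
    exact Cc_le_SectC hU.star (invol_mem_Cc hs)
  · have : invol (0 : ∀ g, E g) = 0 := by
      funext g
      simp [invol]
    rw [this]
    exact zero_mem _
  · intro s t _ _ h1 h2
    have : invol (s + t) = invol s + invol t := by
      funext g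
      simp [invol]
    rw [this]
    exact add_mem h1 h2

variable [IsEtale G]

theorem conv_mem_Cc [T2Space (Obj G)] {U V : Opens G} (hU : IsLocalBisection U)
    (hV : IsLocalBisection V) {s t : ∀ g, E g} (hs : s ∈ Cc E U) (ht : t ∈ Cc E V) :
    conv s t ∈ Cc E (U * V) := by
  have hs0 : ∀ g, g ∉ U → s g = 0 := fun g hg => Cc_eq_zero hs hg
  obtain ⟨hsc, K, hK, hKU, hsK⟩ := hs
  obtain ⟨htc, L, hL, hLV, htL⟩ := ht
  refine ⟨?_, _, isCompact_mul hK hL, ?_, fun g hg => conv_apply_eq_zero hsK htL hg⟩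
  · rw [continuousOn_iff_continuous_domRestrict] at hsc htc ⊢
    have hex : ∀ g : ((U * V : Opens G) : Set G), ∃ h : U, ∃ k : V, Comp h.1 k.1 g.1 := by
      rintro ⟨g, h, hh, k, hk, c⟩
      exact ⟨⟨h, hh⟩, ⟨k, hk⟩, c⟩
    choose α β hc using hex
    have hα : Continuous α := by
      rw [hU.isOpenEmbedding_ran.isInducing.continuous_iff]
      have : (fun u : U => ranMap u.1) ∘ α = fun g => ranMap g.1 :=
        funext fun g => Subtype.ext (hc g).ran_eq.symm
      rw [this]
      exact continuous_ranMap.comp continuous_subtype_val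
    have hβ : Continuous β := by
      rw [hV.isOpenEmbedding_dom.isInducing.continuous_iff]
      have : (fun u : V => domMap u.1) ∘ β = fun g => domMap g.1 :=
        funext fun g => Subtype.ext (hc g).dom_eq.symm
      rw [this]
      exact continuous_domMap.comp continuous_subtype_val
    have h1 : Continuous fun g : ((U * V : Opens G) : Set G) =>
        (⟨(⟨(α g).1, s (α g).1⟩, ⟨(β g).1, t (β g).1⟩), (hc g).mid⟩ :
          {p : Tot E × Tot E // dom p.1.proj = ran p.2.proj}) :=
      Continuous.subtype_mk ((hsc.comp hα).prodMk (htc.comp hβ)) _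
    convert continuous_bmul.comp h1 using 1
    funext g
    have key : ∀ (g' : G) (c : Comp (α g).1 (β g).1 g'),
        (⟨g', conv s t g'⟩ : Tot E) = ⟨mul (α g).1 (β g).1 (hc g).mid,
          bmul (comp_mul _ _ (hc g).mid) (s (α g).1) (t (β g).1)⟩ := by
      intro g' c
      rw [conv_apply_of_comp hU hs0 (α g).2 c]
      obtain ⟨_, rfl⟩ := c
      rfl
    exact key g.1 (hc g)
  · rintro g ⟨h, hh, k, hk, c⟩
    exact ⟨h, hKU hh, k, hLV hk, c⟩

theorem conv_mem [T2Space (Obj G)] {s t : ∀ g, E g} (hs : s ∈ SectC E) (ht : t ∈ SectC E) :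
    conv s t ∈ SectC E := by
  refine SectC_induction (P := fun s => conv s t ∈ SectC E) ?_ ?_ ?_ hs
  · intro U hU s hs
    have hs' := Cc_le_SectC hU hs
    refine SectC_induction (P := fun t => conv s t ∈ SectC E) ?_ ?_ ?_ ht
    · intro V hV t ht
      exact Cc_le_SectC (hU.mul hV) (conv_mem_Cc hU hV hs ht)
    · have : conv s (0 : ∀ g, E g) = 0 := by
        funext g
        simp [conv]
      rw [this]
      exact zero_mem _
    · intro t t' _ _ h1 h2
      rw [conv_add_right hs']
      exact add_mem h1 h2
  · have : conv (0 : ∀ g, E g) t = 0 := by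
      funext g
      simp [conv]
    rw [this]
    exact zero_mem _
  · intro s s' hs hs' h1 h2
    rw [conv_add_left hs hs']
    exact add_mem h1 h2

/-- The multiplication of the convolution algebra. -/
instance [T2Space (Obj G)] : Mul (SectC E) where
  mul s t := ⟨conv s.1 t.1, conv_mem s.2 t.2⟩

/-- The involution of the convolution algebra. -/
instance : Star (SectC E) where
  star s := ⟨invol s.1, invol_mem s.2⟩

end Convolution

/-! ### Compatible completions -/

section Completion

variable {G : Type*} [TopologicalSpace G] [TopologicalGroupoid G] [IsEtale G] [T2Space (Obj G)]
  (E : G → Type*) [∀ g, NormedAddCommGroup (E g)] [∀ g, NormedSpace ℂ (E g)]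
  [∀ g, CompleteSpace (E g)] [TopologicalSpace (Tot E)] [FellBundle E]

/-- A C*-algebra `A` presented as the completion of the convolution algebra of the Fell bundle in a
compatible C*-norm: a `*`-homomorphism with dense image from the convolution algebra to `A`, such
that the norm `s ↦ ‖ι s‖` satisfies `‖s‖_∞ ≤ ‖ι s‖` for every compactly supported section `s`
(so the homomorphism is injective), with equality if `s ∈ C_c(U, E)` for a local bisection `U`. -/
structure CompatibleCompletion (A : Type*) [NonUnitalCStarAlgebra A] where
  ι : SectC E →ₗ[ℂ] A
  map_mul : ∀ s t : SectC E, ι (s * t) = ι s * ι t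
  map_star : ∀ s : SectC E, ι (star s) = star (ι s)
  denseRange : DenseRange ι
  norm_apply_le : ∀ (s : SectC E) (g : G), ‖s.1 g‖ ≤ ‖ι s‖
  norm_eq_iSup : ∀ U : Opens G, IsLocalBisection U → ∀ s : SectC E, s.1 ∈ Cc E U →
    ‖ι s‖ = ⨆ g : G, ‖s.1 g‖

variable {E} {A : Type*} [NonUnitalCStarAlgebra A]

/-- The restriction `A|_U`: the closure in `A` of `C_c(U, E)`. -/
def CompatibleCompletion.restr (a : CompatibleCompletion E A) (U : Opens G) : MaxSpec A :=
  (((Cc E U).comap (SectC E).subtype).map a.ι).closure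

end Completion

end

end FellQuantale

/-! Every open set is the join of the local bisections it contains, so `p^*(V)` has to be the join
`preim V` of the subspaces A|_U with U a local bisection inside V, and uniqueness follows. The work
is to show that joins and products are preserved.

Both rest on a local criterion, `mem_sections_of_forall_mem_closure`. On C_c(U,E) the C*-norm is the
sup norm, and the range map embeds U in the locally compact Hausdorff space G₀, which has partitions
of unity. Hence a section over U belongs to a closed subspace B of A as soon as its value at each
point is a limit of values of sections whose localizations near that point belong to B. For joins
(`restr_le_of_le_sSup`) the approximating section is the given one, localized to members of the
cover. For products (`restr_mul`) it is a sum of convolutions: the value of such a convolution at hk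
is a product s(h)t(k), and by saturation these products span a dense subspace of the fiber, provided
that sections in C_c take a dense set of values in each fiber.

That last fact, `exists_mem_Cc_norm_sub_lt`, is the analytic input. Its source is
`exists_continuousAt_section`, which obtains a continuous local section as a uniform limit of
ε-continuous ones, with ε halved at each stage.

For surjectivity, ‖s(g)‖ ≤ ‖s‖ shows that compactly supported sections lying in `p^*(V)` vanish off
V (`apply_eq_zero_of_mem_sections_preim`). If no fiber is zero, there are enough sections for
`p^*(V)` to determine V. Conversely, the set O of points with nonzero fiber is open and `p^*(O) =
p^*(G)`, so injectivity forces O = G. -/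

namespace FellQuantale

noncomputable section

open TopologicalSpace Bundle Filter Topology

/-! ### Approximate continuity of sections. -/

section NearlyContinuous

variable {X : Type*} [TopologicalSpace X] {E : X → Type*} [∀ x, NormedAddCommGroup (E x)]
  [TopologicalSpace (Tot E)]

/-- A section is `ε`-continuous at `x` if near `x` its values are within `ε` of every neighbourhood
of its value at `x`. -/
def NearlyContinuousAt (ε : ℝ) (f : ∀ x, E x) (x : X) : Prop :=
  ∀ N ∈ 𝓝 (⟨x, f x⟩ : Tot E), ∀ᶠ y in 𝓝 x, ∃ b : E y, (⟨y, b⟩ : Tot E) ∈ N ∧ ‖f y - b‖ < ε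

theorem NearlyContinuousAt.mono {ε δ : ℝ} {f : ∀ x, E x} {x : X}
    (h : NearlyContinuousAt ε f x) (hεδ : ε ≤ δ) : NearlyContinuousAt δ f x := fun N hN =>
  (h N hN).mono fun _ ⟨b, hb, hlt⟩ => ⟨b, hb, hlt.trans_le hεδ⟩

end NearlyContinuous

/-! ### Neighbourhoods in the total space of a Banach bundle. -/

section BanachBundle

variable {X : Type*} [TopologicalSpace X] {E : X → Type*}
  [∀ x, NormedAddCommGroup (E x)] [∀ x, NormedSpace ℂ (E x)] [∀ x, CompleteSpace (E x)]
  [TopologicalSpace (Tot E)] [BanachBundle E]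

namespace BanachBundle

/-- The fiberwise product carries the topology induced from the product of two copies of the total
space, so continuity of addition can be read off on product neighbourhoods. -/
theorem exists_nhds_add {x : X} {a b : E x} {N : Set (Tot E)}
    (hN : N ∈ 𝓝 (⟨x, a + b⟩ : Tot E)) :
    ∃ N₁ ∈ 𝓝 (⟨x, a⟩ : Tot E), ∃ N₂ ∈ 𝓝 (⟨x, b⟩ : Tot E), ∀ (y : X) (a' b' : E y),
      (⟨y, a'⟩ : Tot E) ∈ N₁ → (⟨y, b'⟩ : Tot E) ∈ N₂ → (⟨y, a' + b'⟩ : Tot E) ∈ N := by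
  have h := (continuous_add (E := E)).continuousAt
    (x := (⟨x, (a, b)⟩ : TotalSpace (PUnit.{1} × PUnit.{1}) (E ×ᵇ E)))
  have h1 := h.preimage_mem_nhds hN
  rw [nhds_induced, mem_comap] at h1
  obtain ⟨t, ht, hsub⟩ := h1
  obtain ⟨N₁, h₁, N₂, h₂, h12⟩ := mem_nhds_prod_iff.1 ht
  refine ⟨N₁, h₁, N₂, h₂, fun y a' b' ha hb => ?_⟩
  exact @hsub (⟨y, (a', b')⟩ : TotalSpace (PUnit.{1} × PUnit.{1}) (E ×ᵇ E)) (h12 ⟨ha, hb⟩)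

theorem norm_lt_mem_nhds {x : X} {a : E x} {δ : ℝ} (h : ‖a‖ < δ) :
    {e : Tot E | ‖e.snd‖ < δ} ∈ 𝓝 (⟨x, a⟩ : Tot E) :=
  upperSemicontinuous_norm (⟨x, a⟩ : Tot E) δ h

/-- Joint continuity of scalar multiplication, whereas the axioms give it only for each fixed
scalar. In c'b = cb + (c' - c)b the norm of b is locally bounded by upper semicontinuity, so the
second term falls in a tube around zero. -/
theorem exists_nhds_smul {x : X} {c : ℂ} {a : E x} {N : Set (Tot E)}
    (hN : N ∈ 𝓝 (⟨x, c • a⟩ : Tot E)) :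
    ∃ δ > 0, ∃ N' ∈ 𝓝 (⟨x, a⟩ : Tot E), ∀ (y : X) (c' : ℂ) (b : E y),
      ‖c' - c‖ < δ → (⟨y, b⟩ : Tot E) ∈ N' → (⟨y, c' • b⟩ : Tot E) ∈ N := by
  rw [← add_zero (c • a)] at hN
  obtain ⟨N₁, h₁, N₂, h₂, h12⟩ := exists_nhds_add hN
  obtain ⟨N₃, h3, hN₃, hx3⟩ := mem_nhds_iff.1 h₂
  obtain ⟨ε, hε, U, hU, hxU, hV⟩ := tube_basis x N₃ hN₃ hx3
  have hpos : 0 < ‖a‖ + 1 := by positivity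
  refine ⟨ε / (‖a‖ + 1), by positivity,
    ((fun e : Tot E => (⟨e.proj, c • e.snd⟩ : Tot E)) ⁻¹' N₁ ∩ {e : Tot E | ‖e.snd‖ < ‖a‖ + 1}) ∩
      (fun e : Tot E => e.proj) ⁻¹' U,
    inter_mem (inter_mem ((continuous_smul c).continuousAt.preimage_mem_nhds h₁)
      (norm_lt_mem_nhds (lt_add_one _)))
      ((hU.preimage continuous_proj).mem_nhds hxU), ?_⟩
  rintro y c' b hc ⟨⟨hb1, hb2⟩, hb3⟩
  have e : c' • b = c • b + (c' - c) • b := by rw [← add_smul]; congr 1; ring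
  rw [e]
  refine h12 _ _ _ hb1 (h3 (hV _ hb3 ?_))
  have hb2' : ‖b‖ < ‖a‖ + 1 := hb2
  change ‖(c' - c) • b‖ < ε
  rw [norm_smul]
  calc ‖c' - c‖ * ‖b‖ ≤ ‖c' - c‖ * (‖a‖ + 1) := by gcongr
    _ < ε / (‖a‖ + 1) * (‖a‖ + 1) := by gcongr
    _ = ε := by field_simp

theorem exists_nhds_norm_sub_lt {x : X} {a b : E x} {δ : ℝ} (h : ‖a - b‖ < δ) :
    ∃ N₁ ∈ 𝓝 (⟨x, a⟩ : Tot E), ∃ N₂ ∈ 𝓝 (⟨x, b⟩ : Tot E), ∀ (y : X) (a' b' : E y),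
      (⟨y, a'⟩ : Tot E) ∈ N₁ → (⟨y, b'⟩ : Tot E) ∈ N₂ → ‖a' - b'‖ < δ := by
  have e : ∀ (y : X) (a b : E y), a - b = a + (-1 : ℂ) • b := fun y a b => by
    rw [neg_smul, one_smul, sub_eq_add_neg]
  rw [e] at h
  obtain ⟨N₁, h₁, N₂, h₂, h12⟩ := exists_nhds_add (norm_lt_mem_nhds h)
  refine ⟨N₁, h₁, _, (continuous_smul (-1)).continuousAt.preimage_mem_nhds h₂,
    fun y a' b' ha hb => ?_⟩
  rw [e]
  exact h12 y a' _ ha hb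

/-- Every point of the total space has an open neighbourhood whose intersection with each fiber has
diameter at most `δ`. -/
theorem exists_isOpen_thin (e : Tot E) {δ : ℝ} (hδ : 0 < δ) :
    ∃ T : Set (Tot E), IsOpen T ∧ e ∈ T ∧ ∀ (y : X) (a b : E y),
      (⟨y, a⟩ : Tot E) ∈ T → (⟨y, b⟩ : Tot E) ∈ T → ‖a - b‖ < δ := by
  obtain ⟨N₁, h₁, N₂, h₂, h⟩ :=
    exists_nhds_norm_sub_lt (E := E) (a := e.snd) (b := e.snd) (δ := δ) (by simpa using hδ)
  obtain ⟨T, hT, hTo, he⟩ := mem_nhds_iff.1 (inter_mem h₁ h₂)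
  exact ⟨T, hTo, he, fun y a b ha hb => h y a b (hT ha).1 (hT hb).2⟩

theorem continuousWithinAt_smul_section {φ : X → ℂ} {f : ∀ x, E x} {s : Set X} {x : X}
    (hφ : ContinuousWithinAt φ s x) (hf : ContinuousWithinAt (fun y => (⟨y, f y⟩ : Tot E)) s x) :
    ContinuousWithinAt (fun y => (⟨y, φ y • f y⟩ : Tot E)) s x := by
  intro N hN
  obtain ⟨δ, hδ, N', hN', h⟩ := exists_nhds_smul hN
  rw [mem_map]
  filter_upwards [hf hN', Metric.tendsto_nhds.1 hφ δ hδ] with y h1 h2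
  exact h y _ _ (by rwa [← dist_eq_norm]) h1

theorem eventually_norm_lt {f : ∀ x, E x} {s : Set X} {x : X} {δ : ℝ}
    (hf : ContinuousWithinAt (fun y => (⟨y, f y⟩ : Tot E)) s x) (h : ‖f x‖ < δ) :
    ∀ᶠ y in 𝓝[s] x, ‖f y‖ < δ :=
  hf (norm_lt_mem_nhds h)

end BanachBundle

open BanachBundle

/-! ### Calculus of ε-continuous sections. -/

namespace NearlyContinuousAt

/-- Write f(y) = b + (f(y) - b) with b near f(x). The remainder has small norm, hence is near the
zero of the fiber over x by the tube axiom, and addition is continuous. -/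
theorem continuousAt {f : ∀ x, E x} {x : X} (h : ∀ ε > 0, NearlyContinuousAt ε f x) :
    ContinuousAt (fun y => (⟨y, f y⟩ : Tot E)) x := by
  intro N hN
  change N ∈ 𝓝 (⟨x, f x⟩ : Tot E) at hN
  rw [← add_zero (f x)] at hN
  obtain ⟨N₁, h₁, N₂, h₂, h12⟩ := exists_nhds_add hN
  obtain ⟨N₃, h3, hN₃, hx3⟩ := mem_nhds_iff.1 h₂
  obtain ⟨ε, hε, U, hU, hxU, hV⟩ := tube_basis x N₃ hN₃ hx3
  rw [mem_map]
  filter_upwards [h ε hε N₁ h₁, hU.mem_nhds hxU] with y ⟨b, hb, hlt⟩ hy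
  have := h12 y b (f y - b) hb (h3 (hV _ hy hlt))
  rwa [add_sub_cancel] at this

/-- As the projection is open, N ∩ T meets every fiber near x, and any point of it is within δ of
f(y) because both lie in T. -/
theorem of_thin {T : Set (Tot E)} (hT : IsOpen T) {δ : ℝ}
    (hthin : ∀ (y : X) (a b : E y), (⟨y, a⟩ : Tot E) ∈ T → (⟨y, b⟩ : Tot E) ∈ T → ‖a - b‖ < δ)
    {f : ∀ x, E x} {x : X} (hf : ∀ᶠ y in 𝓝 x, (⟨y, f y⟩ : Tot E) ∈ T) :
    NearlyContinuousAt δ f x := by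
  intro N hN
  have h1 := isOpenMap_proj.image_mem_nhds (inter_mem hN (hT.mem_nhds hf.self_of_nhds))
  filter_upwards [h1, hf] with y hy hfy
  obtain ⟨⟨y, b⟩, ⟨hbN, hbT⟩, rfl⟩ := hy
  exact ⟨b, hbN, hthin _ _ _ hfy hbT⟩

theorem of_eventually_zero {f : ∀ x, E x} {x : X} (hf : ∀ᶠ y in 𝓝 x, f y = 0) {δ : ℝ}
    (hδ : 0 < δ) : NearlyContinuousAt δ f x := by
  intro N hN
  rw [hf.self_of_nhds] at hN
  obtain ⟨N₃, h3, hN₃, hx3⟩ := mem_nhds_iff.1 hN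
  obtain ⟨ε, hε, U, hU, hxU, hV⟩ := tube_basis x N₃ hN₃ hx3
  filter_upwards [hf, hU.mem_nhds hxU] with y h0 hy
  refine ⟨0, h3 (hV _ hy ?_), by simpa [h0] using hδ⟩
  simpa using hε

theorem add {ε δ : ℝ} {f g : ∀ x, E x} {x : X} (hf : NearlyContinuousAt ε f x)
    (hg : NearlyContinuousAt δ g x) : NearlyContinuousAt (ε + δ) (f + g) x := by
  intro N hN
  obtain ⟨N₁, h₁, N₂, h₂, h12⟩ := exists_nhds_add (a := f x) (b := g x) hN
  filter_upwards [hf N₁ h₁, hg N₂ h₂] with y ⟨a, ha, ha'⟩ ⟨b, hb, hb'⟩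
  refine ⟨a + b, h12 y a b ha hb, ?_⟩
  rw [Pi.add_apply, add_sub_add_comm]
  exact (norm_add_le _ _).trans_lt (add_lt_add ha' hb')

theorem smul {ε δ : ℝ} {φ : X → ℂ} {f : ∀ x, E x} {x : X} (hφ : ContinuousAt φ x)
    (hf : NearlyContinuousAt ε f x) (hδ : ‖φ x‖ * ε < δ) :
    NearlyContinuousAt δ (fun y => φ y • f y) x := by
  intro N hN
  obtain ⟨η, hη, N', hN', h⟩ := exists_nhds_smul hN
  have h1 : ∀ᶠ y in 𝓝 x, ‖φ y‖ * ε < δ := (hφ.norm.mul continuousAt_const).eventually_lt_const hδ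
  filter_upwards [hf N' hN', Metric.tendsto_nhds.1 hφ η hη, h1] with y ⟨b, hb, hb'⟩ h2 h3
  refine ⟨φ y • b, h y _ _ (by rwa [← dist_eq_norm]) hb, ?_⟩
  rw [← smul_sub, norm_smul]
  refine lt_of_le_of_lt ?_ h3
  gcongr

/-- The distance δ from f to g is paid twice: once at y, and once at x, where it controls a - b for
a near f(x) and b near g(x). The ε is the distance from g(y) to b. -/
theorem of_norm_sub_le {ε δ η : ℝ} {f g : ∀ x, E x} {x : X} (hg : NearlyContinuousAt ε g x)
    (hfg : ∀ᶠ y in 𝓝 x, ‖f y - g y‖ ≤ δ) (hη : 2 * δ + ε < η) : NearlyContinuousAt η f x := by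
  intro N hN
  have hx : ‖f x - g x‖ < η - ε - δ := hfg.self_of_nhds.trans_lt (by linarith)
  obtain ⟨N₁, h₁, N₂, h₂, h12⟩ := exists_nhds_norm_sub_lt hx
  have h3 := isOpenMap_proj.image_mem_nhds (inter_mem hN h₁)
  filter_upwards [h3, hg N₂ h₂, hfg] with y hy ⟨b, hb, hb'⟩ hy'
  obtain ⟨⟨y, a⟩, ⟨haN, haN₁⟩, rfl⟩ := hy
  refine ⟨a, haN, ?_⟩
  dsimp only at hb hb' hy' ⊢
  have h4 := h12 y a b haN₁ hb
  have h5 : f y - a = (f y - g y) + (g y - b) - (a - b) := by abel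
  rw [h5]
  have h6 := norm_sub_le ((f y - g y) + (g y - b)) (a - b)
  have h7 := norm_add_le (f y - g y) (g y - b)
  linarith

/-- Made for partitions of unity: `f i` need only behave well on the support of `φ i`. The arbitrary
δ absorbs the strict inequalities of the individual terms. -/
theorem sum {ι : Type*} {ε : ℝ} (hε : 0 < ε) (t : Finset ι) {φ : ι → X → ℂ} {f : ι → ∀ x, E x}
    {x : X} (hφ : ∀ i ∈ t, ContinuousAt (φ i) x)
    (hf : ∀ i ∈ t, NearlyContinuousAt ε (f i) x ∨ ∀ᶠ y in 𝓝 x, φ i y = 0) :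
    ∀ δ > 0, NearlyContinuousAt ((∑ i ∈ t, ‖φ i x‖) * ε + δ)
      (∑ i ∈ t, fun y => φ i y • f i y) x := by
  classical
  induction t using Finset.induction_on with
  | empty =>
    intro δ hδ
    exact of_eventually_zero (by simp) (by simpa using hδ)
  | insert i t hi ih =>
    intro δ hδ
    rw [Finset.sum_insert hi, Finset.sum_insert hi]
    have h1 : NearlyContinuousAt (‖φ i x‖ * ε + δ / 2) (fun y => φ i y • f i y) x := by
      rcases hf i (Finset.mem_insert_self i t) with h | h
      · exact h.smul (hφ i (Finset.mem_insert_self i t)) (by linarith)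
      · refine of_eventually_zero (h.mono fun y hy => by rw [hy, zero_smul]) (by positivity)
    have h2 := ih (fun j hj => hφ j (Finset.mem_insert_of_mem hj))
      (fun j hj => hf j (Finset.mem_insert_of_mem hj)) (δ / 2) (by positivity)
    exact (h1.add h2).mono (by linarith)

end NearlyContinuousAt

/-- Partitions of unity, on a set `U` embedded in a locally compact Hausdorff space `B` by `r`,
that are pulled back from `B`. -/
theorem exists_partition_comp {X B : Type*} [TopologicalSpace X] [TopologicalSpace B] [T2Space B]
    [LocallyCompactSpace B] {r : X → B} {U : Set X} (hr : IsOpenEmbedding (U.domRestrict r))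
    {L : Set B} (hL : IsCompact L) (hLU : L ⊆ r '' U) {V : X → Set X}
    (hV : ∀ x ∈ U, r x ∈ L → IsOpen (V x) ∧ x ∈ V x) :
    ∃ (t : Finset {x // x ∈ U ∧ r x ∈ L}) (ψ : t → C(B, ℝ)), (∀ i b, 0 ≤ ψ i b) ∧
      (∀ i, tsupport (ψ i) ⊆ r '' (U ∩ V i.1)) ∧
      (∀ b ∈ L, ∑ i, ψ i b = 1) ∧ ∀ b, ∑ i, ψ i b ≤ 1 := by
  have hop : ∀ i : {x // x ∈ U ∧ r x ∈ L}, IsOpen (r '' (U ∩ V i)) := by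
    intro i
    rw [Set.inter_comm, ← Set.image_domRestrict]
    exact hr.isOpenMap _ ((hV i i.2.1 i.2.2).1.preimage continuous_subtype_val)
  obtain ⟨t, ht⟩ := hL.elim_finite_subcover _ hop fun b hb => by
    obtain ⟨x, hx, rfl⟩ := hLU hb
    exact Set.mem_iUnion.2 ⟨⟨x, hx, hb⟩, x, ⟨hx, (hV x hx hb).2⟩, rfl⟩
  obtain ⟨f, hf, -⟩ := PartitionOfUnity.exists_isSubordinate_of_locallyFinite_t2space hL
    (fun i : t => r '' (U ∩ V i.1)) (fun i => hop i.1) (locallyFinite_of_finite _) (by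
      intro b hb
      obtain ⟨i, hi, h⟩ := Set.mem_iUnion₂.1 (ht hb)
      exact Set.mem_iUnion.2 ⟨⟨i, hi⟩, h⟩)
  refine ⟨t, f, f.nonneg, hf, fun b hb => ?_, fun b => ?_⟩
  · rw [← finsum_eq_sum_of_fintype]
    exact f.sum_eq_one hb
  · rw [← finsum_eq_sum_of_fintype]
    exact f.sum_le_one b

/-! ### Existence of continuous local sections. -/

section Selection

variable {B : Type*} [TopologicalSpace B] [T2Space B] [LocallyCompactSpace B]
  {r : X → B} {U : Set X}

/-- An `ε`-continuous section can be approximated within `ε` by an `ε / 2`-continuous one. -/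
theorem exists_nearlyContinuousAt_half (hrc : Continuous r)
    (hr : IsOpenEmbedding (U.domRestrict r)) {L : Set B} (hL : IsCompact L) (hLU : L ⊆ r '' U)
    {ε : ℝ} (hε : 0 < ε) {f : ∀ x, E x} (hf : ∀ x ∈ U, r x ∈ L → NearlyContinuousAt ε f x) :
    ∃ f' : ∀ x, E x, (∀ x ∈ U, r x ∈ L → NearlyContinuousAt (ε / 2) f' x) ∧
      ∀ x ∈ U, r x ∈ L → ‖f' x - f x‖ ≤ ε := by
  classical
  have hloc : ∀ x, ∃ (V : Set X) (g : ∀ x, E x), x ∈ U → r x ∈ L → IsOpen V ∧ x ∈ V ∧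
      (∀ y ∈ V, NearlyContinuousAt (ε / 4) g y) ∧ ∀ y ∈ V, ‖g y - f y‖ < ε := by
    intro x
    by_cases hx : x ∈ U ∧ r x ∈ L
    -- Near x, the values of g are chosen in a thin open set T around f(x). The ε-continuity of f
    -- allows a choice within ε of f, and thinness makes g ε/4-continuous. Gluing costs at most
    -- another ε/4, for a total of ε/2.
    · obtain ⟨T, hT, hxT, hthin⟩ := exists_isOpen_thin (⟨x, f x⟩ : Tot E) (δ := ε / 4) (by positivity)
      obtain ⟨V, hV, hVo, hxV⟩ := mem_nhds_iff.1 (hf x hx.1 hx.2 T (hT.mem_nhds hxT))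
      have hV' : ∀ y, ∃ b : E y, y ∈ V → (⟨y, b⟩ : Tot E) ∈ T ∧ ‖f y - b‖ < ε := by
        intro y
        by_cases hy : y ∈ V
        · obtain ⟨b, hb⟩ := hV hy
          exact ⟨b, fun _ => hb⟩
        · exact ⟨0, fun h => absurd h hy⟩
      choose g hg using hV'
      refine ⟨V, g, fun _ _ => ⟨hVo, hxV, fun y hy => ?_, fun y hy => ?_⟩⟩
      · exact .of_thin hT hthin (eventually_of_mem (hVo.mem_nhds hy) fun z hz => (hg z hz).1)
      · rw [norm_sub_rev]
        exact (hg y hy).2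
    · exact ⟨∅, 0, fun h1 h2 => absurd ⟨h1, h2⟩ hx⟩
  choose V g hVg using hloc
  obtain ⟨t, ψ, hψ0, hψV, hψ1, -⟩ := exists_partition_comp hr hL hLU
    (V := V) fun x hx hxL => ⟨(hVg x hx hxL).1, (hVg x hx hxL).2.1⟩
  have hmem : ∀ (i : t) (x : X), x ∈ U → r x ∈ tsupport (ψ i) → x ∈ V i.1 := by
    intro i x hx hi
    obtain ⟨y, ⟨hyU, hyV⟩, hy⟩ := hψV i hi
    have : (⟨y, hyU⟩ : U) = ⟨x, hx⟩ := hr.injective hy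
    obtain rfl : y = x := congrArg Subtype.val this
    exact hyV
  refine ⟨∑ i, fun y => (ψ i (r y) : ℂ) • g i.1 y, fun x hx hxL => ?_, fun x hx hxL => ?_⟩
  · have h1 := NearlyContinuousAt.sum (E := E) (ε := ε / 4) (by positivity) Finset.univ
      (φ := fun (i : t) y => (ψ i (r y) : ℂ)) (f := fun i => g i.1) (x := x)
      (fun i _ => by fun_prop) (fun i _ => by
        by_cases hi : r x ∈ tsupport (ψ i)
        · exact Or.inl ((hVg i.1 i.1.2.1 i.1.2.2).2.2.1 x (hmem i x hx hi))
        · refine Or.inr ?_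
          have := ((isClosed_tsupport (ψ i)).isOpen_compl.preimage hrc).mem_nhds hi
          filter_upwards [this] with y hy
          rw [image_eq_zero_of_notMem_tsupport hy, Complex.ofReal_zero]) (ε / 4) (by positivity)
    refine h1.mono ?_
    have h2 : ∑ i, ‖(ψ i (r x) : ℂ)‖ = 1 := by
      rw [← hψ1 _ hxL]
      refine Finset.sum_congr rfl fun i _ => ?_
      rw [Complex.norm_real, Real.norm_of_nonneg (hψ0 i _)]
    rw [h2]
    linarith
  · have h1 : f x = ∑ i, (ψ i (r x) : ℂ) • f x := by
      rw [← Finset.sum_smul, ← Complex.ofReal_sum, hψ1 _ hxL, Complex.ofReal_one, one_smul]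
    rw [Finset.sum_apply]
    conv_lhs => rw [h1, ← Finset.sum_sub_distrib]
    calc ‖∑ i, ((ψ i (r x) : ℂ) • g i.1 x - (ψ i (r x) : ℂ) • f x)‖
        ≤ ∑ i, ψ i (r x) * ε := by
          refine norm_sum_le_of_le _ fun i _ => ?_
          rw [← smul_sub, norm_smul, Complex.norm_real, Real.norm_of_nonneg (hψ0 i _)]
          by_cases hi : r x ∈ tsupport (ψ i)
          · have := (hVg i.1 i.1.2.1 i.1.2.2).2.2.2 x (hmem i x hx hi)
            exact mul_le_mul_of_nonneg_left this.le (hψ0 i _)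
          · rw [image_eq_zero_of_notMem_tsupport hi, zero_mul, zero_mul]
      _ = ε := by rw [← Finset.sum_mul, hψ1 _ hxL, one_mul]

/-- A Banach bundle has local continuous sections through a dense set of points of each fiber. -/
theorem exists_continuousAt_section (hrc : Continuous r) (hU : IsOpen U)
    (hr : IsOpenEmbedding (U.domRestrict r)) {x : X} (hx : x ∈ U) (e : E x) {ε : ℝ} (hε : 0 < ε) :
    ∃ f : ∀ x, E x, ‖f x - e‖ < ε ∧
      ∀ᶠ y in 𝓝 x, ContinuousAt (fun y => (⟨y, f y⟩ : Tot E)) y := by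
  classical
  -- The error at x will be below ε/4 from thinness plus ε/2 from the sum of the corrections
  -- ε/4/2^n.
  obtain ⟨T, hT, hxT, hthin⟩ := exists_isOpen_thin (⟨x, e⟩ : Tot E) (δ := ε / 4) (by positivity)
  have hTx : IsOpen ((fun e : Tot E => e.proj) '' T) := isOpenMap_proj T hT
  have hV : ∀ y, ∃ b : E y, y ∈ (fun e : Tot E => e.proj) '' T → (⟨y, b⟩ : Tot E) ∈ T := by
    intro y
    by_cases hy : y ∈ (fun e : Tot E => e.proj) '' T
    · obtain ⟨⟨y, b⟩, hb, rfl⟩ := hy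
      exact ⟨b, fun _ => hb⟩
    · exact ⟨0, fun h => absurd h hy⟩
  choose f₀ hf₀ using hV
  have hfx : (⟨x, f₀ x⟩ : Tot E) ∈ T := hf₀ x ⟨_, hxT, rfl⟩
  have hO : IsOpen (r '' (U ∩ (fun e : Tot E => e.proj) '' T)) := by
    rw [Set.inter_comm, ← Set.image_domRestrict]
    exact hr.isOpenMap _ (hTx.preimage continuous_subtype_val)
  obtain ⟨L, hLn, hLO, hL⟩ := local_compact_nhds (hO.mem_nhds ⟨x, ⟨hx, _, hxT, rfl⟩, rfl⟩)
  have hLU : L ⊆ r '' U := hLO.trans (Set.image_mono Set.inter_subset_left)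
  have h0 : ∀ y ∈ U, r y ∈ L → NearlyContinuousAt (ε / 4 / 2 ^ 0) f₀ y := by
    intro y hy hyL
    obtain ⟨z, ⟨hzU, hzT⟩, hz⟩ := hLO hyL
    obtain rfl : z = y := congrArg Subtype.val (@hr.injective ⟨z, hzU⟩ ⟨y, hy⟩ hz)
    rw [pow_zero, div_one]
    exact .of_thin hT hthin (eventually_of_mem (hTx.mem_nhds hzT) hf₀)
  have hstep : ∀ (n : ℕ)
      (f : {f : ∀ x, E x // ∀ y ∈ U, r y ∈ L → NearlyContinuousAt (ε / 4 / 2 ^ n) f y}),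
      ∃ f' : {f : ∀ x, E x // ∀ y ∈ U, r y ∈ L → NearlyContinuousAt (ε / 4 / 2 ^ (n + 1)) f y},
        ∀ y ∈ U, r y ∈ L → ‖f'.1 y - f.1 y‖ ≤ ε / 4 / 2 ^ n := by
    rintro n ⟨f, hf⟩
    obtain ⟨f', h1, h2⟩ := exists_nearlyContinuousAt_half hrc hr hL hLU (by positivity) hf
    refine ⟨⟨f', fun y hy hyL => ?_⟩, h2⟩
    rw [pow_succ, ← div_div]
    exact h1 y hy hyL
  choose next hnext using hstep
  let F : ∀ n : ℕ,
      {f : ∀ x, E x // ∀ y ∈ U, r y ∈ L → NearlyContinuousAt (ε / 4 / 2 ^ n) f y} :=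
    fun n => Nat.rec ⟨f₀, h0⟩ next n
  -- The bound ε/4/2^n is written in the form expected by `cauchySeq_of_le_geometric_two`.
  have hF : ∀ y ∈ U, r y ∈ L → ∀ n, dist ((F n).1 y) ((F (n + 1)).1 y) ≤ ε / 2 / 2 / 2 ^ n := by
    intro y hy hyL n
    rw [dist_comm, dist_eq_norm]
    exact (hnext n (F n) y hy hyL).trans_eq (by ring)
  have hlim : ∀ y, ∃ b : E y, y ∈ U → r y ∈ L → Tendsto (fun n => (F n).1 y) atTop (𝓝 b) := by
    intro y
    by_cases hy : y ∈ U ∧ r y ∈ L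
    · obtain ⟨b, hb⟩ := cauchySeq_tendsto_of_complete
        (cauchySeq_of_le_geometric_two (hF y hy.1 hy.2))
      exact ⟨b, fun _ _ => hb⟩
    · exact ⟨0, fun h1 h2 => absurd ⟨h1, h2⟩ hy⟩
  choose f hf using hlim
  have hdist : ∀ n, ∀ y ∈ U, r y ∈ L → ‖f y - (F n).1 y‖ ≤ ε / 2 / 2 ^ n := by
    intro n y hy hyL
    rw [← dist_eq_norm, dist_comm]
    exact dist_le_of_le_geometric_two_of_tendsto (hF y hy hyL) (hf y hy hyL) n
  refine ⟨f, ?_, ?_⟩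
  · have h1 := hdist 0 x hx (mem_of_mem_nhds hLn)
    have h2 : ‖f₀ x - e‖ < ε / 4 := hthin x _ _ hfx hxT
    have h3 : f x - e = (f x - f₀ x) + (f₀ x - e) := by abel
    have h4 := norm_add_le (f x - f₀ x) (f₀ x - e)
    rw [h3]
    change ‖f x - f₀ x‖ ≤ _ at h1
    rw [pow_zero, div_one] at h1
    linarith
  · filter_upwards [hU.mem_nhds hx, (isOpen_interior.preimage hrc).mem_nhds
      (mem_interior_iff_mem_nhds.2 hLn)] with y hyU hyL
    -- Near y the limit is within ε/2/2^n of the ε/4/2^n-continuous section `F n`. By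
    -- `of_norm_sub_le` it is δ-continuous once 2(ε/2/2^n) + ε/4/2^n < δ, which holds for some n.
    refine NearlyContinuousAt.continuousAt fun δ hδ => ?_
    have htend : Tendsto (fun n : ℕ => 2 * (ε / 2 / 2 ^ n) + ε / 4 / 2 ^ n) atTop (𝓝 0) := by
      have h1 : Tendsto (fun n : ℕ => ((1 : ℝ) / 2) ^ n * (5 * ε / 4)) atTop (𝓝 (0 * (5 * ε / 4))) :=
        (tendsto_pow_atTop_nhds_zero_of_lt_one (by norm_num) (by norm_num)).mul_const _
      rw [zero_mul] at h1
      refine h1.congr fun n => ?_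
      rw [div_pow, one_pow]
      ring
    obtain ⟨n, hn⟩ := (htend.eventually_lt_const hδ).exists
    refine ((F n).2 y hyU (interior_subset hyL)).of_norm_sub_le ?_ hn
    filter_upwards [hU.mem_nhds hyU, (isOpen_interior.preimage hrc).mem_nhds hyL] with z hzU hzL
    exact hdist n z hzU (interior_subset hzL)

end Selection

end BanachBundle

open TopologicalGroupoid FellBundle BanachBundle

/-! ### Local bisections. -/

section Bisections

variable {G : Type*} [TopologicalSpace G] [TopologicalGroupoid G]

theorem TopologicalGroupoid.IsLocalBisection.mono {U V : Opens G}
    (hV : IsLocalBisection V) (h : U ≤ V) : IsLocalBisection U :=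
  ⟨hV.1.mono h, hV.2.mono h⟩

/-- Converts support conditions on functions on the object space into membership in open subsets of
the groupoid. -/
theorem TopologicalGroupoid.IsLocalBisection.mem_of_ranMap_mem
    {U W : Opens G} (hU : IsLocalBisection U) {g : G} (hg : g ∈ U)
    (h : ranMap g ∈ ranMap '' ((U : Set G) ∩ W)) : g ∈ W := by
  obtain ⟨g', ⟨h1, h2⟩, e⟩ := h
  obtain rfl : g' = g := hU.2 h1 hg (congrArg Subtype.val e)
  exact h2

theorem exists_isLocalBisection [IsEtale G] {V : Opens G} {g : G} (hg : g ∈ V) :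
    ∃ U : Opens G, IsLocalBisection U ∧ g ∈ U ∧ U ≤ V := by
  obtain ⟨e, he, h1⟩ := isLocalHomeomorph_domMap g
  obtain ⟨e', he', h2⟩ := isLocalHomeomorph_ranMap g
  refine ⟨⟨(e.source ∩ e'.source) ∩ V, (e.open_source.inter e'.open_source).inter V.isOpen⟩,
    ⟨?_, ?_⟩, ⟨⟨he, he'⟩, hg⟩, fun _ h => h.2⟩
  · intro x hx y hy hxy
    refine e.injOn hx.1.1 hy.1.1 ?_
    rw [← h1]
    exact Subtype.ext hxy
  · intro x hx y hy hxy
    refine e'.injOn hx.1.2 hy.1.2 ?_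
    rw [← h2]
    exact Subtype.ext hxy

end Bisections

/-! ### Compactly supported sections and functions on the object space. -/

section Sections

variable {G : Type*} [TopologicalSpace G] [TopologicalGroupoid G] {E : G → Type*}
  [∀ g, NormedAddCommGroup (E g)] [∀ g, NormedSpace ℂ (E g)]

/-- Multiplication of a section by a function on the object space, pulled back by the range map. -/
def ranSMul (ψ : C(Obj G, ℝ)) (s : ∀ g, E g) : ∀ g, E g := fun g => (ψ (ranMap g) : ℂ) • s g

variable [∀ g, CompleteSpace (E g)] [TopologicalSpace (Tot E)] [FellBundle E]

theorem continuousOn_ranSMul (ψ : C(Obj G, ℝ)) {s : ∀ g, E g} {U : Set G}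
    (hs : ContinuousOn (fun g => (⟨g, s g⟩ : Tot E)) U) :
    ContinuousOn (fun g => (⟨g, ranSMul ψ s g⟩ : Tot E)) U := fun g hg =>
  continuousWithinAt_smul_section (φ := fun g => (ψ (ranMap g) : ℂ))
    (Complex.continuous_ofReal.comp (ψ.continuous.comp continuous_ranMap)).continuousWithinAt
    (hs g hg)

theorem ranSMul_mem_Cc (ψ : C(Obj G, ℝ)) {s : ∀ g, E g} {U : Opens G} (hs : s ∈ Cc E U) :
    ranSMul ψ s ∈ Cc E U := by
  obtain ⟨hsc, K, hK, hKU, hsK⟩ := hs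
  exact ⟨continuousOn_ranSMul ψ hsc, K, hK, hKU, fun g hg => by rw [ranSMul, hsK g hg, smul_zero]⟩

theorem ranSMul_mem_Cc_of_tsupport_subset {ψ : C(Obj G, ℝ)} {s : ∀ g, E g} {U W : Opens G}
    (hU : IsLocalBisection U) (hs : s ∈ Cc E U)
    (hψ : tsupport ψ ⊆ ranMap '' ((U : Set G) ∩ W)) : ranSMul ψ s ∈ Cc E (U ⊓ W) := by
  obtain ⟨hsc, K, hK, hKU, hsK⟩ := hs
  refine ⟨(continuousOn_ranSMul ψ hsc).mono fun _ h => h.1, K ∩ ranMap ⁻¹' tsupport ψ,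
    hK.inter_right ((isClosed_tsupport ψ).preimage continuous_ranMap),
    fun g hg => ⟨hKU hg.1, hU.mem_of_ranMap_mem (hKU hg.1) (hψ hg.2)⟩, fun g hg => ?_⟩
  by_cases hgK : g ∈ K
  · have : ranMap g ∉ tsupport ψ := fun h => hg ⟨hgK, h⟩
    rw [ranSMul, image_eq_zero_of_notMem_tsupport this, Complex.ofReal_zero, zero_smul]
  · rw [ranSMul, hsK g hgK, smul_zero]

/-- Since r(hk) = r(h), the scalar is the same in every term of the convolution sum. Thus localizing
a product amounts to localizing its left factor. -/
theorem conv_ranSMul (ψ : C(Obj G, ℝ)) (s t : ∀ g, E g) :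
    conv (ranSMul ψ s) t = ranSMul ψ (conv s t) := by
  funext g
  rw [ranSMul, conv, conv, smul_finsum]
  refine finsum_congr fun p => ?_
  have : ranMap p.1.1 = ranMap g := Subtype.ext p.2.ran_eq.symm
  rw [ranSMul, this, map_smul, LinearMap.smul_apply]

/-- Continuity of the extension by zero needs care, as compact subsets of G need not be closed. But
r(K) is closed in the Hausdorff object space, and r is injective on V, so s vanishes near each point
of V outside U. -/
theorem Cc_mono [T2Space (Obj G)] {U V : Opens G} (hV : IsLocalBisection V) (h : U ≤ V) :
    Cc E U ≤ Cc E V := by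
  rintro s ⟨hsc, K, hK, hKU, hsK⟩
  refine ⟨fun g hg => ContinuousAt.continuousWithinAt ?_, K, hK, hKU.trans h, hsK⟩
  by_cases hgU : g ∈ U
  · exact hsc.continuousAt (U.isOpen.mem_nhds hgU)
  · refine NearlyContinuousAt.continuousAt fun ε hε => .of_eventually_zero ?_ hε
    have hcl : IsClosed (ranMap '' K : Set (Obj G)) := (hK.image continuous_ranMap).isClosed
    have hgK : ranMap g ∉ (ranMap '' K : Set (Obj G)) := by
      rintro ⟨g', hg', e⟩
      obtain rfl : g' = g := hV.2 (h (hKU hg')) hg (congrArg Subtype.val e)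
      exact hgU (hKU hg')
    filter_upwards [(hcl.isOpen_compl.preimage continuous_ranMap).mem_nhds hgK] with y hy
    exact hsK y fun hyK => hy ⟨y, hyK, rfl⟩

variable [IsEtale G] [T2Space (Obj G)] [LocallyCompactSpace (Obj G)]

/-- Compactly supported continuous sections over a local bisection take a dense set of values in
each fiber. -/
theorem exists_mem_Cc_norm_sub_lt {U : Opens G} (hU : IsLocalBisection U) {g : G} (hg : g ∈ U)
    (e : E g) {ε : ℝ} (hε : 0 < ε) : ∃ s ∈ Cc E U, ‖s g - e‖ < ε := by
  classical
  obtain ⟨f, hfe, hf⟩ := exists_continuousAt_section (E := E) continuous_ranMap U.isOpen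
    hU.isOpenEmbedding_ran hg e hε
  obtain ⟨O, hO, hOo, hgO⟩ := mem_nhds_iff.1 (inter_mem hf (U.isOpen.mem_nhds hg))
  let W : Opens G := ⟨O, hOo⟩
  have hWU : W ≤ U := fun y hy => (hO hy).2
  have hW := hU.mono hWU
  have hremb := hW.isOpenEmbedding_ran
  have hrW : IsOpen (ranMap '' (W : Set G) : Set (Obj G)) :=
    isLocalHomeomorph_ranMap.isOpenMap _ W.isOpen
  obtain ⟨ψ, hψ1, hψc, hψs⟩ : ∃ ψ : C(Obj G, ℝ), ψ (ranMap g) = 1 ∧ HasCompactSupport ψ ∧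
      tsupport ψ ⊆ ranMap '' (W : Set G) := by
    obtain ⟨ψ, h1, h2, h3, -⟩ := exists_continuousMap_one_of_isCompact_subset_isOpen
      (isCompact_singleton (x := (ranMap g : Obj G))) hrW
      (Set.singleton_subset_iff.2 ⟨g, hgO, rfl⟩)
    exact ⟨ψ, h1 rfl, h2, h3⟩
  -- The local section f is continuous only on W. The bump function ψ, supported in r(W), cuts it
  -- down to an element of C_c(W,E) with unchanged value at g.
  refine ⟨fun y => if y ∈ W then ranSMul ψ f y else 0, Cc_mono hU hWU
    ⟨?_, Subtype.val '' ((fun u : W => ranMap u.1) ⁻¹' tsupport ψ), ?_, ?_, fun y hy => ?_⟩, ?_⟩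
  · refine (continuousOn_ranSMul ψ (s := f) (U := W) fun y hy =>
      ContinuousAt.continuousWithinAt (hO hy).1).congr fun y hy => ?_
    beta_reduce
    rw [if_pos (show y ∈ W from hy)]
  · refine IsCompact.image (hremb.isInducing.isCompact_preimage' hψc ?_) continuous_subtype_val
    intro b hb
    obtain ⟨y, hy, rfl⟩ := hψs hb
    exact ⟨⟨y, hy⟩, rfl⟩
  · rintro _ ⟨y, -, rfl⟩
    exact y.2
  · beta_reduce
    split_ifs with hyW
    · have : ranMap y ∉ tsupport ψ := fun h => hy ⟨⟨y, hyW⟩, h, rfl⟩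
      rw [ranSMul, image_eq_zero_of_notMem_tsupport this, Complex.ofReal_zero, zero_smul]
    · rfl
  · beta_reduce
    rw [if_pos (show g ∈ W from hgO), ranSMul, hψ1, Complex.ofReal_one, one_smul]
    exact hfe

end Sections

/-! ### Closed subspaces of the completion attached to open sets. -/

namespace CompatibleCompletion

variable {G : Type*} [TopologicalSpace G] [TopologicalGroupoid G] [IsEtale G] [T2Space (Obj G)]
  {E : G → Type*} [∀ g, NormedAddCommGroup (E g)] [∀ g, NormedSpace ℂ (E g)]
  [∀ g, CompleteSpace (E g)] [TopologicalSpace (Tot E)] [FellBundle E]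
  {A : Type*} [NonUnitalCStarAlgebra A] (a : CompatibleCompletion E A)

/-- The compactly supported sections whose image in the completion belongs to `B`. -/
def sections (B : MaxSpec A) : Submodule ℂ (∀ g, E g) :=
  (B.toSubmodule.comap a.ι).map (SectC E).subtype

variable {a}

theorem mem_sections {B : MaxSpec A} {s : ∀ g, E g} :
    s ∈ a.sections B ↔ ∃ h : s ∈ SectC E, a.ι ⟨s, h⟩ ∈ B := by
  constructor
  · rintro ⟨⟨s, h⟩, hs, rfl⟩
    exact ⟨h, hs⟩
  · rintro ⟨h, hs⟩
    exact ⟨⟨s, h⟩, hs, rfl⟩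

/-- As B is closed, inclusions of A|_U in B can be tested on sections, before completing. -/
theorem restr_le_iff {U : Opens G} (hU : IsLocalBisection U) {B : MaxSpec A} :
    a.restr U ≤ B ↔ Cc E U ≤ a.sections B := by
  rw [restr, Submodule.closure_le]
  constructor
  · intro h s hs
    exact mem_sections.2 ⟨Cc_le_SectC hU hs, h ⟨⟨s, Cc_le_SectC hU hs⟩, hs, rfl⟩⟩
  · rintro h _ ⟨s, hs, rfl⟩
    exact (mem_sections.1 (h hs)).2

theorem Cc_le_sections_restr {U : Opens G} (hU : IsLocalBisection U) :
    Cc E U ≤ a.sections (a.restr U) := (restr_le_iff hU).1 le_rfl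

theorem restr_mono {U V : Opens G} (hV : IsLocalBisection V) (h : U ≤ V) :
    a.restr U ≤ a.restr V :=
  (restr_le_iff (hV.mono h)).2 ((Cc_mono hV h).trans (Cc_le_sections_restr hV))

theorem star_restr_le {U : Opens G} (hU : IsLocalBisection U) :
    star (a.restr U) ≤ a.restr (star U) := by
  rw [star_le_iff, restr_le_iff hU]
  intro s hs
  refine mem_sections.2 ⟨Cc_le_SectC hU hs, ?_⟩
  rw [FellQuantale.mem_star_iff, ← a.map_star]
  exact (mem_sections.1 (Cc_le_sections_restr hU.star (invol_mem_Cc hs))).2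

theorem conv_mem_sections_mul {B C : MaxSpec A} {s t : ∀ g, E g} (hs : s ∈ a.sections B)
    (ht : t ∈ a.sections C) : conv s t ∈ a.sections (B * C) := by
  obtain ⟨h1, h2⟩ := mem_sections.1 hs
  obtain ⟨h3, h4⟩ := mem_sections.1 ht
  refine mem_sections.2 ⟨conv_mem h1 h3, ?_⟩
  have := a.map_mul ⟨s, h1⟩ ⟨t, h3⟩
  change a.ι ⟨conv s t, _⟩ = _ at this
  rw [this]
  exact mul_mem_mul h2 h4

theorem restr_mul_le {U V : Opens G} (hU : IsLocalBisection U) (hV : IsLocalBisection V) :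
    a.restr U * a.restr V ≤ a.restr (U * V) := by
  rw [mul_le_iff]
  intro x hx y hy
  have h := map_mem_closure₂ (f := fun x y : A => x * y) (u := (a.restr (U * V) : Set A))
    continuous_mul hx hy ?_
  · rwa [(a.restr (U * V)).isClosed.closure_eq] at h
  · rintro _ ⟨s, hs, rfl⟩ _ ⟨t, ht, rfl⟩
    rw [← a.map_mul]
    exact (mem_sections.1 (Cc_le_sections_restr (hU.mul hV) (conv_mem_Cc hU hV hs ht))).2

theorem mul_mono {B B' C C' : MaxSpec A} (h : B ≤ B') (h' : C ≤ C') : B * C ≤ B' * C' :=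
  mul_le_iff.2 fun _ hx _ hy => mul_mem_mul (h hx) (h' hy)

variable (a)

/-- The inverse image homomorphism of the quantale map determined by the completion. -/
def preim (V : Opens G) : MaxSpec A :=
  ⨆ U : {U : Opens G // IsLocalBisection U ∧ U ≤ V}, a.restr U.1

variable {a}

theorem preim_le_iff {V : Opens G} {B : MaxSpec A} :
    a.preim V ≤ B ↔ ∀ U : Opens G, IsLocalBisection U → U ≤ V → a.restr U ≤ B := by
  rw [preim, iSup_le_iff]
  exact ⟨fun h U h1 h2 => h ⟨U, h1, h2⟩, fun h U => h U.1 U.2.1 U.2.2⟩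

theorem restr_le_preim {U V : Opens G} (hU : IsLocalBisection U) (h : U ≤ V) :
    a.restr U ≤ a.preim V :=
  preim_le_iff.1 le_rfl U hU h

theorem preim_of_isLocalBisection {U : Opens G} (hU : IsLocalBisection U) :
    a.preim U = a.restr U :=
  le_antisymm (preim_le_iff.2 fun _ _ h => restr_mono hU h) (restr_le_preim hU le_rfl)

theorem star_preim_le (V : Opens G) : star (a.preim V) ≤ a.preim (star V) := by
  rw [star_le_iff, preim_le_iff]
  intro U hU hUV
  rw [← star_le_iff]
  exact (star_restr_le hU).trans (restr_le_preim hU.star fun g hg => hUV hg)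

theorem preim_star (V : Opens G) : a.preim (star V) = star (a.preim V) := by
  refine le_antisymm ?_ (star_preim_le V)
  have := star_le_iff.1 (star_preim_le (a := a) (star V))
  rwa [star_star] at this

/-- Sections in the inverse image of `V` vanish outside `V`. -/
theorem apply_eq_zero_of_mem_sections_preim {V : Opens G} {s : ∀ g, E g}
    (hs : s ∈ a.sections (a.preim V)) {g : G} (hg : g ∉ V) : s g = 0 := by
  -- The generators of `preim V` vanish at g, so `preim V` lies in the closure of the image of Z.
  -- Evaluation at g is contractive for the C*-norm, so a section in that closure also vanishes at
  -- g.
  let Z : Submodule ℂ (SectC E) :=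
    { carrier := {t | t.1 g = 0}
      zero_mem' := rfl
      add_mem' := fun {t t'} ht ht' => by
        change t.1 g + t'.1 g = 0
        rw [show t.1 g = 0 from ht, show t'.1 g = 0 from ht', add_zero]
      smul_mem' := fun c t ht => by
        change c • t.1 g = 0
        rw [show t.1 g = 0 from ht, smul_zero] }
  have hle : a.preim V ≤ (Z.map a.ι).closure := by
    rw [preim_le_iff]
    intro U hU hUV
    refine (restr_le_iff hU).2 fun t ht => mem_sections.2 ⟨Cc_le_SectC hU ht, subset_closure ?_⟩
    exact ⟨_, Cc_eq_zero ht fun h => hg (hUV h), rfl⟩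
  obtain ⟨hsS, hsV⟩ := mem_sections.1 hs
  have hcl : a.ι ⟨s, hsS⟩ ∈ closure (Z.map a.ι : Set A) := hle hsV
  rw [← norm_le_zero_iff]
  refine le_of_forall_pos_lt_add fun ε hε => ?_
  obtain ⟨_, ⟨t, ht, rfl⟩, hlt⟩ := Metric.mem_closure_iff.1 hcl ε hε
  rw [dist_eq_norm, ← map_sub] at hlt
  have h1 := a.norm_apply_le (⟨s, hsS⟩ - t) g
  change ‖s g - t.1 g‖ ≤ _ at h1
  rw [show t.1 g = 0 from ht, sub_zero] at h1
  linarith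

/-- Upper semicontinuity of the norm does not keep nonzero vectors away from zero. Instead, the
bundle is Hausdorff over a local bisection, so a nonzero e in the fiber has a neighbourhood disjoint
from a tube around zero, and its projection is open. -/
theorem isOpen_setOf_nontrivial : IsOpen {g : G | Nontrivial (E g)} := by
  rw [isOpen_iff_mem_nhds]
  rintro g (hg : Nontrivial (E g))
  obtain ⟨e, he⟩ := exists_ne (0 : E g)
  obtain ⟨U, hU, hgU, -⟩ := exists_isLocalBisection (V := ⊤) (g := g) trivial
  have : T2Space (U : Set G) := hU.isOpenEmbedding_ran.isEmbedding.t2Space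
  have := t2_restrict (E := E) (U : Set G) U.isOpen inferInstance
  have hπ : IsOpen {e : Tot E | e.proj ∈ (U : Set G)} := U.isOpen.preimage continuous_proj
  obtain ⟨N₁, N₂, ho₁, ho₂, h₁, h₂, hd⟩ := t2_separation
    (x := (⟨⟨g, e⟩, hgU⟩ : {e : Tot E // e.proj ∈ (U : Set G)})) (y := ⟨⟨g, 0⟩, hgU⟩) (by
      intro h
      have h' := congrArg Subtype.val h
      simp only [TotalSpace.mk.injEq, heq_eq_eq, true_and] at h'
      exact he h')
  have hN₁ := hπ.isOpenMap_subtype_val _ ho₁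
  have hN₂ := hπ.isOpenMap_subtype_val _ ho₂
  obtain ⟨ε, hε, W, hW, hgW, hV⟩ := tube_basis g _ hN₂ ⟨_, h₂, rfl⟩
  filter_upwards [(isOpenMap_proj _ hN₁).mem_nhds ⟨_, ⟨_, h₁, rfl⟩, rfl⟩, hW.mem_nhds hgW]
    with y hy hyW
  obtain ⟨_, ⟨⟨⟨y, b⟩, hyU⟩, hb, rfl⟩, rfl⟩ := hy
  refine ⟨b, 0, ?_⟩
  intro hb0
  obtain ⟨⟨z, hz⟩, hzN, hzz⟩ := hV ⟨y, b⟩ hyW (by simpa [hb0] using hε)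
  dsimp only at hzz
  subst hzz
  exact Set.disjoint_left.1 hd hb hzN

/-! ### The local criterion; preservation of joins and products. -/

section LocallyCompact

variable [LocallyCompactSpace (Obj G)]

/-- A section over a local bisection whose values can be approximated at each point by sections
that belong locally to the closed subspace `B` is itself in `B`. -/
theorem mem_sections_of_forall_mem_closure {U : Opens G} (hU : IsLocalBisection U)
    {B : MaxSpec A} {s : ∀ g, E g} (hs : s ∈ Cc E U)
    (h : ∀ g ∈ U, ∃ W : Opens G, g ∈ W ∧ s g ∈ closure {b | ∃ t ∈ Cc E U,
      (∀ ψ : C(Obj G, ℝ), tsupport ψ ⊆ ranMap '' ((U : Set G) ∩ W) →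
        ranSMul ψ t ∈ a.sections B) ∧ t g = b}) : s ∈ a.sections B := by
  have hsS := Cc_le_SectC hU hs
  refine mem_sections.2 ⟨hsS, ?_⟩
  rw [← SetLike.mem_coe, ← B.isClosed.closure_eq, Metric.mem_closure_iff]
  intro ε hε
  have hloc : ∀ g, ∃ (W : Set G) (t : ∀ g, E g), g ∈ U → IsOpen W ∧ g ∈ W ∧ t ∈ Cc E U ∧
      (∀ ψ : C(Obj G, ℝ), tsupport ψ ⊆ ranMap '' ((U : Set G) ∩ W) →
        ranSMul ψ t ∈ a.sections B) ∧ ∀ y ∈ U, y ∈ W → ‖s y - t y‖ ≤ ε / 2 := by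
    intro g
    by_cases hg : g ∈ U
    · obtain ⟨W, hgW, hcl⟩ := h g hg
      obtain ⟨_, ⟨t, ht, htB, rfl⟩, hlt⟩ := Metric.mem_closure_iff.1 hcl (ε / 2) (by positivity)
      rw [dist_eq_norm] at hlt
      have hst := sub_mem hs ht
      -- Upper semicontinuity of the norm spreads the estimate at g to a neighbourhood of g.
      have hev := eventually_norm_lt (f := s - t) (hst.1 g hg) hlt
      rw [U.isOpen.nhdsWithin_eq hg] at hev
      obtain ⟨O, hO, hOo, hgO⟩ := mem_nhds_iff.1 hev
      refine ⟨W ∩ O, t, fun _ => ⟨W.isOpen.inter hOo, ⟨hgW, hgO⟩, ht, fun ψ hψ => htB ψ ?_,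
        fun y _ hy => (hO hy.2).le⟩⟩
      exact hψ.trans (Set.image_mono (Set.inter_subset_inter_right _ Set.inter_subset_left))
    · exact ⟨∅, 0, fun h => absurd h hg⟩
  choose W t hWt using hloc
  have hs0 := hs
  obtain ⟨-, K, hK, hKU, hsK⟩ := hs0
  obtain ⟨I, ψ, hψ0, hψW, hψ1, hψle⟩ := exists_partition_comp
    (r := (ranMap : G → Obj G)) (U := (U : Set G)) hU.isOpenEmbedding_ran
    (hK.image continuous_ranMap) (Set.image_mono hKU)
    (V := W) fun g hg _ => ⟨(hWt g hg).1, (hWt g hg).2.1⟩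
  have hmem : ∀ i : I, ranSMul (ψ i) (t i.1) ∈ a.sections B := fun i =>
    (hWt i.1 i.1.2.1).2.2.2.1 (ψ i) (hψW i)
  obtain ⟨hs'S, hs'B⟩ := mem_sections.1 (Submodule.sum_mem _ fun (i : I) (_ : i ∈ Finset.univ) =>
    hmem i)
  refine ⟨_, hs'B, ?_⟩
  rw [dist_eq_norm, ← map_sub]
  have hs'U : ∑ i, ranSMul (ψ i) (t i.1) ∈ Cc E U := Submodule.sum_mem _ fun i _ =>
    ranSMul_mem_Cc (ψ i) (hWt i.1 i.1.2.1).2.2.1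
  -- The difference lies in C_c(U,E) for a single bisection U, so its C*-norm is its sup norm and
  -- pointwise estimates suffice.
  rw [a.norm_eq_iSup U hU _ (sub_mem hs hs'U)]
  refine lt_of_le_of_lt (Real.iSup_le (fun g => ?_) (by positivity)) (half_lt_self hε)
  change ‖s g - (∑ i, ranSMul (ψ i) (t i.1)) g‖ ≤ ε / 2
  by_cases hg : g ∈ U
  -- Off K the functions `ψ i` need not sum to 1, but s vanishes there.
  · have h1 : s g = ∑ i, (ψ i (ranMap g) : ℂ) • s g := by
      by_cases hgK : g ∈ K
      · rw [← Finset.sum_smul, ← Complex.ofReal_sum, hψ1 _ ⟨g, hgK, rfl⟩, Complex.ofReal_one,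
          one_smul]
      · simp [hsK g hgK]
    rw [Finset.sum_apply]
    conv_lhs => rw [h1, ← Finset.sum_sub_distrib]
    calc ‖∑ i, ((ψ i (ranMap g) : ℂ) • s g - ranSMul (ψ i) (t i.1) g)‖
        ≤ ∑ i, ψ i (ranMap g) * (ε / 2) := by
          refine norm_sum_le_of_le _ fun i _ => ?_
          rw [ranSMul, ← smul_sub, norm_smul, Complex.norm_real, Real.norm_of_nonneg (hψ0 i _)]
          by_cases hi : ranMap g ∈ tsupport (ψ i)
          · have hgW : g ∈ W i.1 :=
              hU.mem_of_ranMap_mem (W := ⟨W i.1, (hWt i.1 i.1.2.1).1⟩) hg (hψW i hi)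
            exact mul_le_mul_of_nonneg_left ((hWt i.1 i.1.2.1).2.2.2.2 g hg hgW) (hψ0 i _)
          · rw [image_eq_zero_of_notMem_tsupport hi, zero_mul, zero_mul]
      _ ≤ 1 * (ε / 2) := by
          rw [← Finset.sum_mul]
          exact mul_le_mul_of_nonneg_right (hψle _) (by positivity)
      _ = ε / 2 := one_mul _
  · rw [Cc_eq_zero hs hg, Cc_eq_zero hs'U hg, sub_zero, norm_zero]
    positivity

/-- The local criterion with s as its own approximation: around a point of W ∈ S, localizations of s
are sections over U ⊓ W, hence over W, and these lie in B. -/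
theorem restr_le_of_le_sSup {U : Opens G} (hU : IsLocalBisection U) {S : Set (Opens G)}
    (hS : ∀ W ∈ S, IsLocalBisection W) (hUS : U ≤ sSup S) {B : MaxSpec A}
    (hB : ∀ W ∈ S, a.restr W ≤ B) : a.restr U ≤ B := by
  rw [restr_le_iff hU]
  intro s hs
  refine mem_sections_of_forall_mem_closure hU hs fun g hg => ?_
  obtain ⟨W, hW, hgW⟩ := Opens.mem_sSup.1 (hUS hg)
  refine ⟨W, hgW, subset_closure ⟨s, hs, fun ψ hψ => ?_, rfl⟩⟩
  exact (restr_le_iff (hS W hW)).1 (hB W hW) (Cc_mono (hS W hW) inf_le_right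
    (ranSMul_mem_Cc_of_tsupport_subset hU hs hψ))

theorem restr_mul (hE : IsSaturated E) {U V : Opens G} (hU : IsLocalBisection U)
    (hV : IsLocalBisection V) : a.restr (U * V) = a.restr U * a.restr V := by
  refine le_antisymm ?_ (restr_mul_le hU hV)
  rw [restr_le_iff (hU.mul hV)]
  intro s hs
  refine mem_sections_of_forall_mem_closure (hU.mul hV) hs fun g hg => ⟨⊤, trivial, ?_⟩
  obtain ⟨h, hh, k, hk, c⟩ := hg
  -- P consists of the values at g of the admissible approximants. It is a subspace containing the
  -- value at g of every convolution from C_c(U,E) and C_c(V,E), so its density follows from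
  -- saturation. Convolutions stay admissible under every ψ, hence no localization is needed and ⊤
  -- serves as neighbourhood.
  let P : Submodule ℂ (E g) :=
    { carrier := {b | ∃ t ∈ Cc E (U * V), (∀ ψ : C(Obj G, ℝ),
        ranSMul ψ t ∈ a.sections (a.restr U * a.restr V)) ∧ t g = b}
      zero_mem' := by
        refine ⟨0, zero_mem _, fun ψ => ?_, rfl⟩
        convert zero_mem (a.sections (a.restr U * a.restr V)) using 1
        funext y
        simp [ranSMul]
      add_mem' := by
        rintro _ _ ⟨t, ht, htB, rfl⟩ ⟨t', ht', htB', rfl⟩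
        refine ⟨t + t', add_mem ht ht', fun ψ => ?_, rfl⟩
        convert add_mem (htB ψ) (htB' ψ) using 1
        funext y
        simp [ranSMul]
      smul_mem' := by
        rintro z _ ⟨t, ht, htB, rfl⟩
        refine ⟨z • t, Submodule.smul_mem _ z ht, fun ψ => ?_, rfl⟩
        convert Submodule.smul_mem _ z (htB ψ) using 1
        funext y
        simp only [ranSMul, Pi.smul_apply]
        rw [smul_comm] }
  have hdense : ∀ (W : Opens G), IsLocalBisection W → ∀ y ∈ W, ∀ b : E y,
      b ∈ closure {b | ∃ t ∈ Cc E W, t y = b} := by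
    intro W hW y hy b
    rw [Metric.mem_closure_iff]
    intro ε hε
    obtain ⟨t, ht, hlt⟩ := exists_mem_Cc_norm_sub_lt hW hy b hε
    exact ⟨_, ⟨t, ht, rfl⟩, by rwa [dist_comm, dist_eq_norm]⟩
  have hcont : Continuous fun p : E h × E k => bmul c p.1 p.2 :=
    ((bmul (E := E) c).mkContinuous₂ 1 fun x y => by
      simpa using norm_bmul_le c x y).continuous₂
  have hmul : ∀ (x : E h) (y : E k), bmul c x y ∈ closure (P : Set (E g)) := by
    intro x y
    refine map_mem_closure₂ (f := fun x y => bmul c x y) hcont (hdense U hU h hh x)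
      (hdense V hV k hk y) ?_
    rintro _ ⟨s₁, hs₁, rfl⟩ _ ⟨t₁, ht₁, rfl⟩
    refine ⟨conv s₁ t₁, conv_mem_Cc hU hV hs₁ ht₁, fun ψ => ?_,
      conv_apply_of_comp hU (fun _ hg => Cc_eq_zero hs₁ hg) hh c⟩
    rw [← conv_ranSMul]
    exact conv_mem_sections_mul (Cc_le_sections_restr hU (ranSMul_mem_Cc ψ hs₁))
      (Cc_le_sections_restr hV ht₁)
  have hle : Submodule.span ℂ (Set.range fun p : E h × E k => bmul c p.1 p.2) ≤
      P.topologicalClosure := Submodule.span_le.2 (by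
    rintro _ ⟨p, rfl⟩
    exact hmul p.1 p.2)
  have hsg : s g ∈ closure (P : Set (E g)) := by
    have h1 : s g ∈ closure
        (Submodule.span ℂ (Set.range fun p : E h × E k => bmul c p.1 p.2) : Set (E g)) := by
      rw [hE h k g c]
      trivial
    exact closure_minimal hle isClosed_closure h1
  refine closure_mono ?_ hsg
  rintro _ ⟨t, ht, htB, rfl⟩
  exact ⟨t, ht, fun ψ _ => htB ψ, rfl⟩

theorem preim_le_of_le_sSup {V : Opens G} {S : Set (Opens G)}
    (hS : ∀ W ∈ S, IsLocalBisection W) (hVS : V ≤ sSup S) {B : MaxSpec A}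
    (hB : ∀ W ∈ S, a.restr W ≤ B) : a.preim V ≤ B :=
  preim_le_iff.2 fun _ hU h => restr_le_of_le_sSup hU hS (h.trans hVS) hB

theorem preim_sSup_of_isLocalBisection {S : Set (Opens G)} (hS : ∀ W ∈ S, IsLocalBisection W) :
    a.preim (sSup S) = ⨆ W ∈ S, a.restr W :=
  le_antisymm (preim_le_of_le_sSup hS le_rfl fun W hW => le_iSup₂_of_le W hW le_rfl)
    (iSup₂_le fun W hW => restr_le_preim (hS W hW) (le_sSup hW))

/-- The bisections contained in some member of S already cover `sSup S`. -/
theorem preim_sSup (S : Set (Opens G)) : a.preim (sSup S) = ⨆ V ∈ S, a.preim V := by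
  refine le_antisymm (preim_le_of_le_sSup
    (S := {U | IsLocalBisection U ∧ ∃ V ∈ S, U ≤ V}) (fun U hU => hU.1) ?_ ?_) ?_
  · intro g hg
    obtain ⟨V, hV, hgV⟩ := Opens.mem_sSup.1 hg
    obtain ⟨U, hU, hgU, hUV⟩ := exists_isLocalBisection hgV
    exact Opens.mem_sSup.2 ⟨U, ⟨hU, V, hV, hUV⟩, hgU⟩
  · rintro U ⟨hU, V, hV, hUV⟩
    exact le_iSup₂_of_le V hV (restr_le_preim hU hUV)
  · exact iSup₂_le fun V hV => preim_le_iff.2 fun U hU hUV =>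
      restr_le_preim hU (hUV.trans (le_sSup hV))

theorem preim_mul (hE : IsSaturated E) (V W : Opens G) :
    a.preim (V * W) = a.preim V * a.preim W := by
  apply le_antisymm
  · refine preim_le_of_le_sSup (S := {T | ∃ U U' : Opens G, IsLocalBisection U ∧
      IsLocalBisection U' ∧ U ≤ V ∧ U' ≤ W ∧ T = U * U'}) ?_ ?_ ?_
    · rintro _ ⟨U, U', hU, hU', -, -, rfl⟩
      exact hU.mul hU'
    · rintro g ⟨h, hh, k, hk, c⟩
      obtain ⟨U, hU, hhU, hUV⟩ := exists_isLocalBisection hh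
      obtain ⟨U', hU', hkU', hUW⟩ := exists_isLocalBisection hk
      exact Opens.mem_sSup.2 ⟨U * U', ⟨U, U', hU, hU', hUV, hUW, rfl⟩, h, hhU, k, hkU', c⟩
    · rintro _ ⟨U, U', hU, hU', hUV, hUW, rfl⟩
      rw [restr_mul hE hU hU']
      exact mul_mono (restr_le_preim hU hUV) (restr_le_preim hU' hUW)
  -- Passing to the quotients `leftQuot` and `rightQuot` reduces each join in turn to a single
  -- bisection.
  · rw [mul_le_iff_left, preim_le_iff]
    intro U hU hUV
    rw [← mul_le_iff_left, mul_le_iff_right, preim_le_iff]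
    intro U' hU' hUW
    rw [← mul_le_iff_right]
    refine (restr_mul_le hU hU').trans (restr_le_preim (hU.mul hU') ?_)
    rintro g ⟨h, hh, k, hk, c⟩
    exact ⟨h, hUV hh, k, hUW hk, c⟩

variable (a)

/-- The map of involutive quantales from `Max A` to the topology of the groupoid. -/
def quantaleMap (hE : IsSaturated E) : QuantaleMap (MaxSpec A) (Opens G) where
  invImage :=
    { toFun := a.preim
      map_sSup := preim_sSup
      map_mul := preim_mul hE
      map_star := preim_star }

variable {a}

/-! ### Surjectivity and nondegeneracy. -/

theorem preim_injective_of_isNondegenerate (hE : IsNondegenerate E) :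
    Function.Injective a.preim := by
  have key : ∀ V W : Opens G, a.preim V ≤ a.preim W → V ≤ W := by
    intro V W hVW g hg
    by_contra hgW
    obtain ⟨U, hU, hgU, hUV⟩ := exists_isLocalBisection hg
    have := hE g
    obtain ⟨e, he⟩ := exists_ne (0 : E g)
    -- A section closer to e than ‖e‖ cannot vanish at g.
    obtain ⟨s, hs, hlt⟩ := exists_mem_Cc_norm_sub_lt hU hgU e (norm_pos_iff.2 he)
    have h1 := (restr_le_iff hU).1 ((restr_le_preim (a := a) hU hUV).trans hVW) hs
    rw [apply_eq_zero_of_mem_sections_preim h1 hgW, zero_sub, norm_neg] at hlt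
    exact lt_irrefl _ hlt
  exact fun V W h => le_antisymm (key V W h.le) (key W V h.ge)

theorem isNondegenerate_of_preim_injective (h : Function.Injective a.preim) :
    IsNondegenerate E := by
  let O : Opens G := ⟨{g | Nontrivial (E g)}, isOpen_setOf_nontrivial⟩
  -- The local criterion shows that O and ⊤ have the same image: on O a section approximates itself,
  -- and at a point with zero fiber the zero section has the right value.
  have hO : O = ⊤ := h (le_antisymm
    (preim_le_iff.2 fun U hU _ => restr_le_preim hU le_top) (preim_le_iff.2 fun U hU _ => by
      rw [restr_le_iff hU]
      intro s hs
      refine mem_sections_of_forall_mem_closure hU hs fun g hg => ?_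
      by_cases hgO : g ∈ O
      · refine ⟨O, hgO, subset_closure ⟨s, hs, fun ψ hψ => ?_, rfl⟩⟩
        have hUO := hU.mono (inf_le_left : U ⊓ O ≤ U)
        exact (restr_le_iff hUO).1 (restr_le_preim hUO inf_le_right)
          (ranSMul_mem_Cc_of_tsupport_subset hU hs hψ)
      · have : Subsingleton (E g) := not_nontrivial_iff_subsingleton.1 hgO
        refine ⟨⊤, trivial, subset_closure ⟨0, zero_mem _, fun ψ _ => ?_,
          Subsingleton.elim _ _⟩⟩
        convert zero_mem (a.sections (a.preim O)) using 1
        funext y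
        simp [ranSMul]))
  intro g
  have : g ∈ O := hO ▸ trivial
  exact this

end LocallyCompact

end CompatibleCompletion

end

end FellQuantale

/-! ### The main theorem. -/

theorem theorem3 {G : Type*} [TopologicalSpace G] [FellQuantale.TopologicalGroupoid G]
    [FellQuantale.TopologicalGroupoid.IsEtale G]
    [T2Space (FellQuantale.TopologicalGroupoid.Obj G)]
    [LocallyCompactSpace (FellQuantale.TopologicalGroupoid.Obj G)]
    (E : G → Type*) [∀ g, NormedAddCommGroup (E g)] [∀ g, NormedSpace ℂ (E g)]
    [∀ g, CompleteSpace (E g)] [TopologicalSpace (FellQuantale.Tot E)]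
    [FellQuantale.FellBundle E] (hE : FellQuantale.IsSaturated E)
    (A : Type*) [NonUnitalCStarAlgebra A] (a : FellQuantale.CompatibleCompletion E A) :
    ∃ p : FellQuantale.QuantaleMap (FellQuantale.MaxSpec A) (TopologicalSpace.Opens G),
      (∀ U : TopologicalSpace.Opens G, FellQuantale.TopologicalGroupoid.IsLocalBisection U →
        p.invImage.toFun U = a.restr U) ∧
      (∀ q : FellQuantale.QuantaleMap (FellQuantale.MaxSpec A) (TopologicalSpace.Opens G),
        (∀ U : TopologicalSpace.Opens G, FellQuantale.TopologicalGroupoid.IsLocalBisection U →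
          q.invImage.toFun U = a.restr U) → q = p) ∧
      (∀ (V : TopologicalSpace.Opens G) (S : Set (TopologicalSpace.Opens G)),
        (∀ U ∈ S, FellQuantale.TopologicalGroupoid.IsLocalBisection U) → V = sSup S →
          p.invImage.toFun V = ⨆ U ∈ S, a.restr U) ∧
      (p.IsSurjection ↔ FellQuantale.IsNondegenerate E) := by
  refine ⟨a.quantaleMap hE, fun U hU => ?_, fun q hq => ?_, fun V S hS hV => ?_, ?_, ?_⟩
  · exact FellQuantale.CompatibleCompletion.preim_of_isLocalBisection hU
  · refine FellQuantale.QuantaleMap.ext (FellQuantale.InvolutiveQuantaleHom.ext (funext fun V => ?_))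
    -- Uniqueness: V is the join of its local bisections, and q preserves joins.
    let S : Set (TopologicalSpace.Opens G) :=
      {U | FellQuantale.TopologicalGroupoid.IsLocalBisection U ∧ U ≤ V}
    have hS : V = sSup S := by
      refine le_antisymm (fun g hg => ?_) (sSup_le fun U hU => hU.2)
      obtain ⟨U, hU, hgU, hUV⟩ := FellQuantale.exists_isLocalBisection hg
      exact TopologicalSpace.Opens.mem_sSup.2 ⟨U, ⟨hU, hUV⟩, hgU⟩
    have h1 : q.invImage.toFun V = ⨆ U ∈ S, a.restr U := by
      rw [hS, q.invImage.map_sSup]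
      exact iSup_congr fun U => iSup_congr fun hU => hq U hU.1
    have h2 := FellQuantale.CompatibleCompletion.preim_sSup_of_isLocalBisection (a := a)
      (S := S) fun U hU => hU.1
    rw [← hS] at h2
    exact h1.trans h2.symm
  · rw [hV]
    exact FellQuantale.CompatibleCompletion.preim_sSup_of_isLocalBisection hS
  · exact FellQuantale.CompatibleCompletion.isNondegenerate_of_preim_injective
  · exact FellQuantale.CompatibleCompletion.preim_injective_of_isNondegenerate
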